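/- Let $\alpha>0$. For $m\ge 0$ let $L_m^{(\alpha)}(x)=\sum_{k=0}^m(-1)^k\binom{m+\alpha}{m-k}\frac{x^k}{k!}$ be the classical Laguerre polynomials, $L_m^{(\alpha)}=0$ for $m<0$. Put $$q_0=0,\qquad q_n(x)=\sqrt{\frac{(\alpha+n-1)\,(n-1)!}{(\alpha+n)\,\Gamma(n+\alpha)}}\Big(-(x+\alpha+1)L_{n-1}^{(\alpha)}(x)+L_{n-2}^{(\alpha)}(x)\Big)\quad(n\ge1),\qquad w(x)=\frac{e^{-x}x^\alpha}{(x+\alpha)^2}.$$ Differential operators are operators $\sum_j c_j(x)\,\frac{d^j}{dx^j}$ on $C^\infty((0,\infty))$ with coefficients $c_j\in C^\infty((0,\infty))$. A symmetric difference operator of order at most $2k$ is a symmetric matrix $L=(L_{n,m})_{n,m\ge0}$ with $L_{n,m}=0$ for $|n-m|>k$, acting by $(Lq)_n=\sum_mL_{n,m}q_m$; we write $\delta^{j}$ for the entries $(n,n+j)$. Let $\mathcal F^{d,k}_{x,sym}$ be the space of differential operators $D$ of order at most $2d$ for which there is a symmetric difference operator $L$ of order at most $2k$ with $Dq_n=(Lq)_n$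 for all $n\ge0$. Let $$D_0=\frac x4\frac{d^2}{dx^2}+\frac{(\alpha+x+1)(\alpha-x)}{4(\alpha+x)}\frac{d}{dx}+\frac{\alpha+3x}{4(\alpha+x)},\qquad D_2=(x+\alpha)^2,$$ $$D_1=\frac{(3\alpha-x+10)x}{42}\frac{d^2}{dx^2}+\frac{3\alpha^3-\alpha^2x-3\alpha x^2+x^3+13\alpha^2-5\alpha x-10x^2+10\alpha-10x}{42(\alpha+x)}\frac{d}{dx}-\frac{\alpha^3-\alpha x^2+5\alpha^2-3\alpha x+10\alpha-10x}{42(\alpha+x)},$$ $$L_0=\frac{3-n}4,$$ $$L_1=-\tfrac1{42}\sqrt{\alpha+n}\sqrt{\alpha+n-1}\sqrt{\alpha+n-2}\sqrt{n-1}\;\delta^{-1}+\tfrac{(n-1)(n-5)}{21}-\tfrac1{42}\sqrt{\alpha+n+1}\sqrt{\alpha+n}\sqrt{\alpha+n-1}\sqrt n\;\delta,$$ $$\begin{aligned}L_2=\;&\sqrt{\alpha+n}\sqrt{\alpha+n-3}\sqrt{n-1}\sqrt{n-2}\;\delta^{-2}-4\sqrt{\alpha+n}\sqrt{\alpha+n-1}\sqrt{\alpha+n-2}\sqrt{n-1}\;\delta^{-1}\\&+(4\alpha^2+10\alpha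 n+6n^2-5\alpha-6n)-4\sqrt{\alpha+n+1}\sqrt{\alpha+n}\sqrt{\alpha+n-1}\sqrt n\;\delta\\&+\sqrt{\alpha+n+2}\sqrt{\alpha+n-1}\sqrt{n+1}\sqrt n\;\delta^{2}\end{aligned}$$ (entries with a negative column index are absent, and a product of square roots with a factor $\sqrt0$ is $0$). For $\Omega>0$ and $N\in\mathbb N_0$ let $$\begin{aligned}T=\;&1764D_1^2+168(\Omega-3\alpha-10)(D_0D_1+D_1D_0)+16(\Omega-3\alpha-10)^2D_0^2+4(N+\alpha)(D_0D_2+D_2D_0)\\&+42\big(2N\Omega+2N\alpha+4\alpha^2-5\Omega+15\alpha+40\big)D_1\\&+4\big(-8N\Omega\alpha-2\Omega^2\alpha-8N\alpha^2-14\alpha^3-20N\Omega-5\Omega^2-20N\alpha+30\Omega\alpha-85\alpha^2+90\Omega-270\alpha-400\big)D_0\\&+(N+\alpha)(N-\alpha-5)D_2 .\end{aligned}$$ Let $(Sf)(y)=\int_0^\Omega\big(\sum_{k=0}^Nq_k(x)q_k(y)\,w(x)\big)f(x)\,dx$. Then: 1. $q_0=0$, $\deg q_n=n$ for $n\ge1$,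 and $\{q_n\}_{n\ge1}$ is a complete orthonormal system in $L^2((0,\infty),w\,dx)$. 2. $L_0,L_1,L_2$ are symmetric difference operators of order at most $0,2,4$ respectively, and $D_jq_n=(L_jq)_n$ for all $n\ge0$ and $j=0,1,2$. 3. The $8$ operators $Id,\ D_0,\ D_1,\ D_2,\ D_0^2,\ D_1^2,\ D_0D_1+D_1D_0,\ D_2D_0+D_0D_2$ belong to $\mathcal F^{2,2}_{x,sym}$ and are linearly independent over $\mathbb R$. 4. For all $\Omega>0$ and $N\in\mathbb N_0$: $T\in\mathcal F^{2,2}_{x,sym}$; $T$ has order four, with leading coefficient $f_2$; and $T=w^{-1/2}\big(\sum_{k=0}^2\partial_x^k\,f_k\,\partial_x^k\big)w^{1/2}$, where, with $u=x+\alpha$, $$f_2=(\Omega-x)^2x^2,$$ $$f_1=\frac{\Omega-x}{u^2}\Big(-\tfrac12\Omega u^4+\tfrac12x(x-3\alpha)u^3-2Nxu^3+2\Omega x(\alpha-x)-2x(x^2+4\alpha x+\alpha^2)\Big),$$ $$\begin{aligned}16f_0=\;&x^4-4\alpha x^3-2\alpha^2x^2-24x^2+12\alpha^3x-71\alpha^4-560\alpha^3-2116\alpha^2-4800\alpha-6400-\tfrac{32\alpha^3}{u}-\tfrac{64\alpha^2}{u^2}+\tfrac{192\alpha^3}{u^3}-\tfrac{128\alpha^4}{u^4}\\&+\Omega\Big(-2x^3+12\alpha^2x+16x-16\alpha^3+632\alpha+1600+\tfrac{6\alpha^4}{x}-\tfrac{32\alpha^2}{u}-\tfrac{64\alpha}{u^2}+\tfrac{288\alpha^2}{u^3}-\tfrac{256\alpha^3}{u^4}\Big)\\&+\Omega^2\Big(x^2+4\alpha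 x-10\alpha^2-80\alpha-96+\tfrac{4\alpha^3-8\alpha}{x}+\tfrac{\alpha^4-4\alpha^2}{x^2}+\tfrac{96\alpha}{u^3}-\tfrac{128\alpha^2}{u^4}\Big)\\&+N\Big(-8x^3+8\alpha x^2+40\alpha^2x+32x-40\alpha^3-320\alpha^2-576\alpha-\tfrac{32\alpha^2}{u}\Big)\\&+N\Omega\Big(8x^2+24\alpha x-40\alpha^2-320\alpha-640+\tfrac{8\alpha^3}{x}-\tfrac{32\alpha}{u}\Big)+16N^2u^2 .\end{aligned}$$ 5. For all $\Omega>0$ and $N\in\mathbb N_0$, $T$ commutes with $S$ on $(0,\Omega)$: let $\mathcal D$ be the set of $f$ of class $C^4$ on $(0,\Omega)$ with $f,f',f'',f'''$ bounded on $(0,\Omega)$ and $Tf\in L^2((0,\Omega),w\,dx)$. If $f\in\mathcal D$, then $Sf\in\mathcal D$ and $T(Sf)=S(Tf)$ on $(0,\Omega)$. -/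

import Mathlib

open MeasureTheory Polynomial
open scoped ContDiff

noncomputable section

namespace ExLaguerre

/-! ## Smooth functions and differential operators on the half line `(0, ∞)` -/

/-- The real algebra `C^∞((0, ∞))` of smooth real functions on `(0, ∞)`. -/
def SmoothFn : Subalgebra ℝ (Set.Ioi (0 : ℝ) → ℝ) where
  carrier := {f | ∃ g : ℝ → ℝ, ContDiffOn ℝ ∞ g (Set.Ioi 0) ∧ ∀ x : Set.Ioi (0 : ℝ), f x = g x}
  mul_mem' := by
    rintro a b ⟨g, hg, hga⟩ ⟨h, hh, hhb⟩
    exact ⟨fun x => g x * h x, hg.mul hh, fun x => by simp [hga, hhb]⟩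
  add_mem' := by
    rintro a b ⟨g, hg, hga⟩ ⟨h, hh, hhb⟩
    exact ⟨fun x => g x + h x, hg.add hh, fun x => by simp [hga, hhb]⟩
  algebraMap_mem' := by
    intro r
    exact ⟨fun _ => r, contDiffOn_const, fun x => by simp⟩

/-- The restriction to `(0, ∞)` of a real function which is smooth there. -/
def smoothOf (g : ℝ → ℝ) (hg : ContDiffOn ℝ ∞ g (Set.Ioi 0)) : SmoothFn :=
  ⟨fun x => g x, g, hg, fun _ => rfl⟩

/-- Extension by zero of a smooth function on `(0, ∞)` to the real line. -/
def ext (f : SmoothFn) : ℝ → ℝ := Function.extend Subtype.val f.1 0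

theorem ext_apply (f : SmoothFn) (x : Set.Ioi (0 : ℝ)) : ext f x = f.1 x :=
  Subtype.val_injective.extend_apply f.1 0 x

theorem ext_contDiffOn (f : SmoothFn) : ContDiffOn ℝ ∞ (ext f) (Set.Ioi 0) := by
  obtain ⟨g, hg, hfg⟩ := f.2
  exact hg.congr fun x hx => (ext_apply f ⟨x, hx⟩).trans (hfg ⟨x, hx⟩)

theorem ext_differentiableAt (f : SmoothFn) (x : Set.Ioi (0 : ℝ)) :
    DifferentiableAt ℝ (ext f) x :=
  ((ext_contDiffOn f).contDiffAt (Ioi_mem_nhds x.2)).differentiableAt (by simp)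

theorem ext_eventuallyEq_add (f g : SmoothFn) (x : Set.Ioi (0 : ℝ)) :
    ext (f + g) =ᶠ[nhds (x : ℝ)] fun y => ext f y + ext g y := by
  filter_upwards [Ioi_mem_nhds x.2] with y hy
  rw [ext_apply (f + g) ⟨y, hy⟩, ext_apply f ⟨y, hy⟩, ext_apply g ⟨y, hy⟩]
  rfl

theorem ext_eventuallyEq_smul (r : ℝ) (f : SmoothFn) (x : Set.Ioi (0 : ℝ)) :
    ext (r • f) =ᶠ[nhds (x : ℝ)] fun y => r * ext f y := by
  filter_upwards [Ioi_mem_nhds x.2] with y hy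
  rw [ext_apply (r • f) ⟨y, hy⟩, ext_apply f ⟨y, hy⟩]
  rfl

/-- The derivation `d/dx` on `C^∞((0, ∞))`. -/
def ddx : Module.End ℝ SmoothFn where
  toFun f := smoothOf (deriv (ext f))
    ((ext_contDiffOn f).deriv_of_isOpen isOpen_Ioi (by simp))
  map_add' f g := by
    apply Subtype.ext
    funext x
    change deriv (ext (f + g)) x = deriv (ext f) x + deriv (ext g) x
    rw [(ext_eventuallyEq_add f g x).deriv_eq]
    exact deriv_add (ext_differentiableAt f x) (ext_differentiableAt g x)
  map_smul' r f := by
    apply Subtype.ext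
    funext x
    change deriv (ext (r • f)) x = r * deriv (ext f) x
    rw [(ext_eventuallyEq_smul r f x).deriv_eq]
    exact deriv_const_mul r (ext_differentiableAt f x)

/-- The operator of multiplication by a smooth function. Operators are composed with `*`. -/
def mulOp (g : SmoothFn) : Module.End ℝ SmoothFn := LinearMap.mulLeft ℝ g

/-- The differential operator `∑_{j ≤ m} c_j (d/dx)^j` on `C^∞((0, ∞))`. -/
def diffOp (m : ℕ) (c : ℕ → SmoothFn) : Module.End ℝ SmoothFn :=
  ∑ j ∈ Finset.range (m + 1), mulOp (c j) * ddx ^ j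

/-- The same expression `∑_{j ≤ m} c_j f^{(j)}`, for functions `f` that need not be smooth
nor defined on the whole of `(0, ∞)`; it is used only at points of an open subset of `(0, ∞)` on
which `f` is `m` times differentiable. -/
def diffAct (m : ℕ) (c : ℕ → SmoothFn) (f : ℝ → ℝ) (x : ℝ) : ℝ :=
  ∑ j ∈ Finset.range (m + 1), ext (c j) x * iteratedDeriv j f x

/-! ## Fourier algebras -/

/-- The action of a band matrix of bandwidth at most `k` on a sequence:
`(L q)_n = ∑_{j ≤ n + k} L_{n,j} q_j`. -/
def bandAct (k : ℕ) (L : Matrix ℕ ℕ ℝ) (q : ℕ → SmoothFn) (n : ℕ) : SmoothFn :=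
  ∑ j ∈ Finset.range (n + k + 1), L n j • q j

/-- `L` is (the semi-infinite matrix of) a symmetric difference operator
`∑_{j=-k}^{k} L_j δ^j`, that is, of order at most `2 k`. -/
def IsSymmBand (k : ℕ) (L : Matrix ℕ ℕ ℝ) : Prop :=
  L.IsSymm ∧ ∀ i j : ℕ, (i + k < j ∨ j + k < i) → L i j = 0

/-- The space `𝓕_{x,sym}^{d,k}` of a sequence `q`: differential operators `A` of order at most
`2 d` such that `A q_n = (L q)_n` for all `n`, for some symmetric difference operator `L` of order
at most `2 k`. -/
def FourierSym (q : ℕ → SmoothFn) (d k : ℕ) : Submodule ℝ (Module.End ℝ SmoothFn) where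
  carrier := {A | (∃ c : ℕ → SmoothFn, A = diffOp (2 * d) c) ∧
    ∃ L : Matrix ℕ ℕ ℝ, IsSymmBand k L ∧ ∀ n, A (q n) = bandAct k L q n}
  add_mem' := by
    rintro A B ⟨⟨a, ha⟩, L, ⟨hL, hLb⟩, hA⟩ ⟨⟨b, hb⟩, M, ⟨hM, hMb⟩, hB⟩
    refine ⟨⟨a + b, ?_⟩, L + M, ⟨hL.add hM, fun i j h => ?_⟩, fun n => ?_⟩
    · rw [ha, hb, diffOp, diffOp, diffOp, ← Finset.sum_add_distrib]
      refine Finset.sum_congr rfl fun j _ => ?_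
      rw [← add_mul]
      congr 1
      ext f
      simp [mulOp, add_mul]
    · rw [Matrix.add_apply, hLb i j h, hMb i j h, add_zero]
    · rw [LinearMap.add_apply, hA, hB, bandAct, bandAct, bandAct, ← Finset.sum_add_distrib]
      exact Finset.sum_congr rfl fun j _ => by rw [Matrix.add_apply, add_smul]
  zero_mem' := by
    refine ⟨⟨0, ?_⟩, 0, ⟨Matrix.isSymm_zero, fun _ _ _ => rfl⟩, fun n => ?_⟩
    · rw [diffOp, eq_comm]
      refine Finset.sum_eq_zero fun j _ => ?_
      have : mulOp ((0 : ℕ → SmoothFn) j) = 0 := by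
        ext f
        simp [mulOp]
      rw [this, zero_mul]
    · simp [bandAct]
  smul_mem' := by
    rintro r A ⟨⟨a, ha⟩, L, ⟨hL, hLb⟩, hA⟩
    refine ⟨⟨r • a, ?_⟩, r • L, ⟨hL.smul r, fun i j h => ?_⟩, fun n => ?_⟩
    · rw [ha, diffOp, diffOp, Finset.smul_sum]
      refine Finset.sum_congr rfl fun j _ => ?_
      rw [← smul_mul_assoc]
      congr 1
      ext f
      simp [mulOp]
    · rw [Matrix.smul_apply, hLb i j h, smul_zero]
    · rw [LinearMap.smul_apply, hA, bandAct, bandAct, Finset.smul_sum]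
      exact Finset.sum_congr rfl fun j _ => by rw [Matrix.smul_apply, smul_assoc]

/-! ## Exceptional Laguerre polynomials -/

/-- The classical Laguerre polynomial
`L_m^{(α)}(x) = ∑_{k ≤ m} (-1)^k binom(m + α, m - k) x^k / k!`, where
`binom(m + α, m - k) = (α + k + 1) (α + k + 2) ⋯ (α + m) / (m - k)!`. -/
def laguerre (α : ℝ) (m : ℕ) : ℝ[X] :=
  ∑ k ∈ Finset.range (m + 1),
    C ((-1) ^ k * (ascPochhammer ℝ (m - k)).eval (α + k + 1)
      / ((m - k).factorial * k.factorial)) * X ^ k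

/-- Laguerre polynomials with an integer index, zero for negative indices. -/
def laguerreZ (α : ℝ) : ℤ → ℝ[X]
  | Int.ofNat m => laguerre α m
  | Int.negSucc _ => 0

/-- The exceptional Laguerre polynomials. At `n = 0` both Laguerre polynomials vanish, so that the
value of the normalization factor there is irrelevant. -/
def xLaguerre (α : ℝ) (n : ℕ) : ℝ[X] :=
  C (√((α + n - 1) * (n - 1).factorial / ((α + n) * Real.Gamma (n + α)))) *
    (-(X + C α + 1) * laguerreZ α ((n : ℤ) - 1) + laguerreZ α ((n : ℤ) - 2))

/-- The exceptional Laguerre polynomials as smooth functions on `(0, ∞)`. -/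
def qfun (α : ℝ) (n : ℕ) : SmoothFn :=
  smoothOf (fun x => (xLaguerre α n).eval x) (by
    simpa using ((xLaguerre α n).contDiff_aeval (𝕜 := ℝ) ∞).contDiffOn)

/-- The weight `w(x) = e^{-x} x^α / (x + α)^2` on `(0, ∞)`. -/
def weight (α x : ℝ) : ℝ := Real.exp (-x) * x ^ α / (x + α) ^ 2

/-- The measure `w(x) dx` on `(0, ∞)`. -/
def weightMeasure (α : ℝ) : Measure ℝ :=
  (volume.restrict (Set.Ioi 0)).withDensity fun x => ENNReal.ofReal (weight α x)

/-! ## The operators `D_0`, `D_1`, `D_2`, `T` -/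

theorem add_ne (α : ℝ) (hα : 0 < α) : ∀ x ∈ Set.Ioi (0 : ℝ), x + α ≠ 0 :=
  fun _ hx => (add_pos hx hα).ne'

theorem contDiffOn_div_pow (α : ℝ) (hα : 0 < α) (n : ℕ) (g : ℝ → ℝ) (hg : ContDiff ℝ ∞ g) :
    ContDiffOn ℝ ∞ (fun x => g x / (x + α) ^ n) (Set.Ioi 0) :=
  hg.contDiffOn.div (by fun_prop) fun x hx => pow_ne_zero n (add_ne α hα x hx)

theorem contDiffOn_div (α : ℝ) (hα : 0 < α) (b : ℝ) (g : ℝ → ℝ) (hg : ContDiff ℝ ∞ g)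
    (hb : b ≠ 0) : ContDiffOn ℝ ∞ (fun x => g x / (b * (x + α))) (Set.Ioi 0) :=
  hg.contDiffOn.div (by fun_prop) fun x hx => mul_ne_zero hb (add_ne α hα x hx)

theorem weight_contDiffOn (α : ℝ) (hα : 0 < α) :
    ContDiffOn ℝ ∞ (weight α) (Set.Ioi 0) := by
  refine ContDiffOn.div (ContDiffOn.mul (by fun_prop) ?_) (by fun_prop)
    fun x hx => pow_ne_zero 2 (add_ne α hα x hx)
  exact contDiffOn_id.rpow_const_of_ne fun x hx => (ne_of_gt hx)

theorem weight_pos (α : ℝ) (hα : 0 < α) (x : ℝ) (hx : x ∈ Set.Ioi (0 : ℝ)) : 0 < weight α x := by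
  have h : 0 < x := hx
  unfold weight
  positivity

/-- The function `w^r` on `(0, ∞)`. -/
def weightPow (α : ℝ) (hα : 0 < α) (r : ℝ) : SmoothFn :=
  smoothOf (fun x => weight α x ^ r)
    ((weight_contDiffOn α hα).rpow_const_of_ne fun x hx => (weight_pos α hα x hx).ne')

/-- The second order operator `D_0`. -/
def D0 (α : ℝ) (hα : 0 < α) : Module.End ℝ SmoothFn :=
  mulOp (smoothOf (fun x => x / 4) (by fun_prop)) * ddx ^ 2 +
  mulOp (smoothOf (fun x => (α + x + 1) * (α - x) / (4 * (x + α)))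
    (contDiffOn_div α hα 4 _ (by fun_prop) (by norm_num))) * ddx +
  mulOp (smoothOf (fun x => (α + 3 * x) / (4 * (x + α)))
    (contDiffOn_div α hα 4 _ (by fun_prop) (by norm_num)))

/-- The second order operator `D_1`. -/
def D1 (α : ℝ) (hα : 0 < α) : Module.End ℝ SmoothFn :=
  mulOp (smoothOf (fun x => (3 * α - x + 10) * x / 42) (by fun_prop)) * ddx ^ 2 +
  mulOp (smoothOf (fun x => (3 * α ^ 3 - α ^ 2 * x - 3 * α * x ^ 2 + x ^ 3 + 13 * α ^ 2
      - 5 * α * x - 10 * x ^ 2 + 10 * α - 10 * x) / (42 * (x + α)))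
    (contDiffOn_div α hα 42 _ (by fun_prop) (by norm_num))) * ddx -
  mulOp (smoothOf (fun x => (α ^ 3 - α * x ^ 2 + 5 * α ^ 2 - 3 * α * x + 10 * α - 10 * x)
      / (42 * (x + α)))
    (contDiffOn_div α hα 42 _ (by fun_prop) (by norm_num)))

/-- The multiplication operator `D_2 = (x + α)^2`. -/
def D2 (α : ℝ) : Module.End ℝ SmoothFn :=
  mulOp (smoothOf (fun x => (x + α) ^ 2) (by fun_prop))

/-- The difference operator `L_0 = (3 - n) / 4`. -/
def L0 : Matrix ℕ ℕ ℝ := fun n m => if m = n then (3 - (n : ℝ)) / 4 else 0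

/-- The difference operator `L_1`, of order 2. -/
def L1 (α : ℝ) : Matrix ℕ ℕ ℝ := fun n m =>
  if m + 1 = n then -(√(α + n) * √(α + n - 1) * √(α + n - 2) * √((n : ℝ) - 1)) / 42
  else if m = n then ((n : ℝ) - 1) * (n - 5) / 21
  else if m = n + 1 then -(√(α + n + 1) * √(α + n) * √(α + n - 1) * √(n : ℝ)) / 42
  else 0

/-- The difference operator `L_2`, of order 4. -/
def L2 (α : ℝ) : Matrix ℕ ℕ ℝ := fun n m =>
  if m + 2 = n then √(α + n) * √(α + n - 3) * √((n : ℝ) - 1) * √((n : ℝ) - 2)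
  else if m + 1 = n then -4 * √(α + n) * √(α + n - 1) * √(α + n - 2) * √((n : ℝ) - 1)
  else if m = n then 4 * α ^ 2 + 10 * α * n + 6 * (n : ℝ) ^ 2 - 5 * α - 6 * n
  else if m = n + 1 then -4 * √(α + n + 1) * √(α + n) * √(α + n - 1) * √(n : ℝ)
  else if m = n + 2 then √(α + n + 2) * √(α + n - 1) * √((n : ℝ) + 1) * √(n : ℝ)
  else 0

/-- The eight operators
`Id, D_0, D_1, D_2, D_0^2, D_1^2, D_0 D_1 + D_1 D_0, D_2 D_0 + D_0 D_2`. -/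
def Y (α : ℝ) (hα : 0 < α) : Fin 8 → Module.End ℝ SmoothFn :=
  ![1, D0 α hα, D1 α hα, D2 α, D0 α hα ^ 2, D1 α hα ^ 2,
    D0 α hα * D1 α hα + D1 α hα * D0 α hα, D2 α * D0 α hα + D0 α hα * D2 α]

/-- The commuting operator `T`. -/
def T (α : ℝ) (hα : 0 < α) (Ω N : ℝ) : Module.End ℝ SmoothFn :=
  (1764 : ℝ) • D1 α hα ^ 2
  + (168 * (Ω - 3 * α - 10)) • (D0 α hα * D1 α hα + D1 α hα * D0 α hα)
  + (16 * (Ω - 3 * α - 10) ^ 2) • D0 α hα ^ 2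
  + (4 * (N + α)) • (D0 α hα * D2 α + D2 α * D0 α hα)
  + (42 * (2 * N * Ω + 2 * N * α + 4 * α ^ 2 - 5 * Ω + 15 * α + 40)) • D1 α hα
  + (4 * (-8 * N * Ω * α - 2 * Ω ^ 2 * α - 8 * N * α ^ 2 - 14 * α ^ 3 - 20 * N * Ω - 5 * Ω ^ 2
      - 20 * N * α + 30 * Ω * α - 85 * α ^ 2 + 90 * Ω - 270 * α - 400)) • D0 α hα
  + ((N + α) * (N - α - 5)) • D2 α

/-! ## The coefficients of `T` in symmetric form -/

/-- `f_2(x) = (Ω - x)^2 x^2`. -/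
def f2 (Ω : ℝ) : SmoothFn := smoothOf (fun x => (Ω - x) ^ 2 * x ^ 2) (by fun_prop)

/-- The coefficient `f_1`. -/
def f1 (α : ℝ) (hα : 0 < α) (Ω N : ℝ) : SmoothFn :=
  smoothOf (fun x => (Ω - x) *
      (-Ω * (x + α) ^ 4 / 2 + x * (x + α) ^ 3 * (x - 3 * α) / 2 - 2 * N * x * (x + α) ^ 3
        + 2 * Ω * x * (α - x) - 2 * x * (x ^ 2 + 4 * α * x + α ^ 2)) / (x + α) ^ 2)
    (contDiffOn_div_pow α hα 2 _ (by fun_prop))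

/-- The coefficient `f_0` as a function on the line. -/
def f0Fun (α Ω N x : ℝ) : ℝ :=
  ((x ^ 4 - 4 * α * x ^ 3 - 2 * α ^ 2 * x ^ 2 - 24 * x ^ 2 + 12 * α ^ 3 * x - 71 * α ^ 4
      - 560 * α ^ 3 - 2116 * α ^ 2 - 4800 * α - 6400
      - 32 * α ^ 3 / (x + α) - 64 * α ^ 2 / (x + α) ^ 2 + 192 * α ^ 3 / (x + α) ^ 3
      - 128 * α ^ 4 / (x + α) ^ 4)
    + Ω * (-2 * x ^ 3 + 12 * α ^ 2 * x + 16 * x - 16 * α ^ 3 + 632 * α + 1600 + 6 * α ^ 4 / x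
      - 32 * α ^ 2 / (x + α) - 64 * α / (x + α) ^ 2 + 288 * α ^ 2 / (x + α) ^ 3
      - 256 * α ^ 3 / (x + α) ^ 4)
    + Ω ^ 2 * (x ^ 2 + 4 * α * x - 10 * α ^ 2 - 80 * α - 96 + (4 * α ^ 3 - 8 * α) / x
      + (α ^ 4 - 4 * α ^ 2) / x ^ 2 + 96 * α / (x + α) ^ 3 - 128 * α ^ 2 / (x + α) ^ 4)
    + N * (-8 * x ^ 3 + 8 * α * x ^ 2 + 40 * α ^ 2 * x + 32 * x - 40 * α ^ 3 - 320 * α ^ 2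
      - 576 * α - 32 * α ^ 2 / (x + α))
    + N * Ω * (8 * x ^ 2 + 24 * α * x - 40 * α ^ 2 - 320 * α - 640 + 8 * α ^ 3 / x
      - 32 * α / (x + α))
    + 16 * N ^ 2 * (x + α) ^ 2) / 16

theorem f0Fun_contDiffOn (α : ℝ) (hα : 0 < α) (Ω N : ℝ) :
    ContDiffOn ℝ ∞ (f0Fun α Ω N) (Set.Ioi 0) := by
  intro x hx
  have h1 : x + α ≠ 0 := add_ne α hα x hx
  have h2 : x ≠ 0 := ne_of_gt hx
  unfold f0Fun
  fun_prop (disch := simp [h1, h2])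

/-- The coefficient `f_0`. -/
def f0 (α : ℝ) (hα : 0 < α) (Ω N : ℝ) : SmoothFn :=
  smoothOf (f0Fun α Ω N) (f0Fun_contDiffOn α hα Ω N)

/-! ## The integral operator `S` and the domain of `T` on `(0, Ω)` -/

/-- The integral operator
`(S f)(y) = ∫_0^Ω (∑_{k=0}^N q_k(x) q_k(y)) w(x) f(x) dx`. -/
def S (α Ω : ℝ) (N : ℕ) (f : ℝ → ℝ) (y : ℝ) : ℝ :=
  ∫ x in Set.Ioo 0 Ω, (∑ k ∈ Finset.range (N + 1),
    (xLaguerre α k).eval x * (xLaguerre α k).eval y * weight α x) * f x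

/-- The domain, in `L^2((0, Ω), w dx)`, of the differential operator `∑_{j ≤ 4} c_j (d/dx)^j`:
functions of class `C^4` on `(0, Ω)` with `f, f', f'', f'''` bounded, which the operator maps into
`L^2((0, Ω), w dx)`. -/
def domT (α Ω : ℝ) (c : ℕ → SmoothFn) : Set (ℝ → ℝ) :=
  {f | ContDiffOn ℝ 4 f (Set.Ioo 0 Ω) ∧
    (∀ j ≤ 3, ∃ B : ℝ, ∀ x ∈ Set.Ioo 0 Ω, |iteratedDeriv j f x| ≤ B) ∧
    MemLp (diffAct 4 c f) 2 ((weightMeasure α).restrict (Set.Ioo 0 Ω))}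

end ExLaguerre

end

/-!
The exceptional Laguerre polynomials are Darboux transforms of classical ones:
`q_{m+1} = c_m A L_m^{(α-1)}` with `A y = (x + α) y' - (x + α + 1) y` (`xLaguerre_succ`).
Everything about the `q_n` follows from Laguerre's equation for `y = L_m^{(α-1)}`.

* Relations. Raising and lowering operators express the neighbours of `y` in `y` and `y'`, so that
  each `D_j q_n = (L_j q)_n` becomes an identity between the coefficients of `y` and `y'`, once the
  higher derivatives are eliminated by Laguerre's equation (`D0_qfun`, `D1_qfun`, `D2_qfun`).
* Orthonormality. `∫ (Ay)(Az) w = (α + m + 1) ∫ y z x^{α-1} e^{-x}`, because the difference of the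
  integrands is the derivative of a function vanishing at both ends
  (`integral_darboux_mul_darboux`); the right side is the classical orthogonality.
* Completeness. By degree, the `q_n` span all polynomials with `p'(-α) = p(-α)`, in particular
  `(x + α)^2 x^k`. If `f` is orthogonal to all `q_n`, then `(x + α)^2 f` has vanishing moments for
  `w dx`, hence is zero since it has exponential moments (`ae_eq_zero_of_moments`).

The operators `D_0`, `D_1`, `D_2` are formally symmetric for the weight `w`, that is of the form
`w⁻¹ ∂ w p ∂ + r`. The anticommutator of two such operators is `w⁻¹ ∂² w a ∂² + w⁻¹ ∂ w g ∂ + c`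
with explicit `a`, `g`, `c` (`slOp_anticomm`), and these three coefficients are unique
(`symOp_eq_zero`). Linear independence of the eight operators and the symmetric form of `T`
(`T_eq_symOp`) are therefore read off from coefficients; conjugation by `w^{1/2}` gives the form
with `f_0`, `f_1`, `f_2` (`conj_eq_symOp_gT`).

Commutation with `S` rests on two facts. The symmetric matrix of `T` in the `q_n` has bandwidth two,
and its entries `(N, N+1)`, `(N, N+2)`, `(N-1, N+1)` vanish, so that `T` preserves the span of
`q_0, …, q_N` (`matT_eq_zero`). And Green's formula for `T` on `(0, Ω)` has no boundary terms: they
vanish at `0` because `w` does, and at `Ω` because `f_2`, its derivative and the coefficient `g` of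
`T` contain the factor `Ω - x` (`integral_green`). Hence `T (S f)` and `S (T f)` have the same
coefficients in `q_0, …, q_N`.
-/

noncomputable section

namespace ExLaguerre

/-! ### The differential algebra of smooth functions on the half line -/

theorem ddx_mul (f g : SmoothFn) : ddx (f * g) = ddx f * g + f * ddx g := by
  apply Subtype.ext
  funext x
  have h : ext (f * g) =ᶠ[nhds (x : ℝ)] fun y => ext f y * ext g y := by
    filter_upwards [Ioi_mem_nhds x.2] with y hy
    rw [ext_apply (f * g) ⟨y, hy⟩, ext_apply f ⟨y, hy⟩, ext_apply g ⟨y, hy⟩]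
    rfl
  change deriv (ext (f * g)) x = deriv (ext f) x * g.1 x + f.1 x * deriv (ext g) x
  rw [h.deriv_eq, ← ext_apply, ← ext_apply]
  exact deriv_mul (ext_differentiableAt f x) (ext_differentiableAt g x)

theorem ext_smoothOf (g : ℝ → ℝ) (hg : ContDiffOn ℝ ∞ g (Set.Ioi 0)) {x : ℝ} (hx : 0 < x) :
    ext (smoothOf g hg) x = g x :=
  ext_apply (smoothOf g hg) ⟨x, hx⟩

theorem ddx_smoothOf {g g' : ℝ → ℝ} (hg : ContDiffOn ℝ ∞ g (Set.Ioi 0))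
    (hg' : ContDiffOn ℝ ∞ g' (Set.Ioi 0)) (h : ∀ x, 0 < x → HasDerivAt g (g' x) x) :
    ddx (smoothOf g hg) = smoothOf g' hg' := by
  apply Subtype.ext
  funext x
  have e : ext (smoothOf g hg) =ᶠ[nhds (x : ℝ)] g := by
    filter_upwards [Ioi_mem_nhds x.2] with y hy
    exact ext_smoothOf g hg hy
  change deriv (ext (smoothOf g hg)) x = g' x
  rw [e.deriv_eq, (h x x.2).deriv]

theorem hasDerivAt_ext (f : SmoothFn) {x : ℝ} (hx : 0 < x) :
    HasDerivAt (ext f) (ext (ddx f) x) x := by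
  rw [ext_apply (ddx f) ⟨x, hx⟩]
  exact (ext_differentiableAt f ⟨x, hx⟩).hasDerivAt

theorem ddx_algebraMap (r : ℝ) : ddx (algebraMap ℝ SmoothFn r) = 0 := by
  have h : algebraMap ℝ SmoothFn r = smoothOf (fun _ => r) contDiffOn_const := rfl
  rw [h, ddx_smoothOf _ (g' := fun _ => 0) contDiffOn_const fun x _ => hasDerivAt_const x r]
  rfl

theorem ddx_one : ddx (1 : SmoothFn) = 0 := by
  simpa using ddx_algebraMap 1

theorem ddx_ofNat (n : ℕ) [n.AtLeastTwo] : ddx (ofNat(n) : SmoothFn) = 0 := by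
  rw [← map_ofNat (algebraMap ℝ SmoothFn) n]
  exact ddx_algebraMap _

/-- Evaluation of smooth functions at a point of `(0, ∞)`. -/
def ev (x : Set.Ioi (0 : ℝ)) : SmoothFn →ₐ[ℝ] ℝ :=
  (Pi.evalAlgHom ℝ (fun _ => ℝ) x).comp SmoothFn.val

theorem ev_apply (x : Set.Ioi (0 : ℝ)) (f : SmoothFn) : ev x f = f.1 x := rfl

theorem ev_eq_ext (x : Set.Ioi (0 : ℝ)) (f : SmoothFn) : ev x f = ext f x := (ext_apply f x).symm

theorem ev_smoothOf (x : Set.Ioi (0 : ℝ)) (g : ℝ → ℝ) (hg : ContDiffOn ℝ ∞ g (Set.Ioi 0)) :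
    ev x (smoothOf g hg) = g x := rfl

theorem ev_injective {f g : SmoothFn} (h : ∀ x, ev x f = ev x g) : f = g :=
  Subtype.ext (funext h)

theorem mulOp_apply (g f : SmoothFn) : mulOp g f = g * f := rfl

/-- The coordinate function `x`. -/
def coordX : SmoothFn := smoothOf (fun x => x) (by fun_prop)

/-- The function `1 / x`. -/
def invX : SmoothFn :=
  smoothOf (fun x => x⁻¹) (contDiffOn_id.inv fun _ hx => ne_of_gt hx)

/-- The function `1 / (x + α)`. -/
def invU (α : ℝ) (hα : 0 < α) : SmoothFn :=
  smoothOf (fun x => (x + α)⁻¹) (ContDiffOn.inv (by fun_prop) (add_ne α hα))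

theorem ddx_coordX : ddx coordX = 1 :=
  ddx_smoothOf _ (g' := fun _ => 1) contDiffOn_const fun x _ => hasDerivAt_id x

theorem ddx_invX : ddx invX = -(invX * invX) := by
  have h : ContDiffOn ℝ ∞ (fun x : ℝ => -(x⁻¹ * x⁻¹)) (Set.Ioi 0) := by
    have h := contDiffOn_id (𝕜 := ℝ) (n := ∞) (s := Set.Ioi (0 : ℝ)) |>.inv
      fun _ hx => ne_of_gt hx
    exact (h.mul h).neg
  refine (ddx_smoothOf _ h fun x hx => ?_).trans rfl
  exact (hasDerivAt_inv hx.ne').congr_deriv (by field_simp)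

theorem ddx_invU (α : ℝ) (hα : 0 < α) : ddx (invU α hα) = -(invU α hα * invU α hα) := by
  have h : ContDiffOn ℝ ∞ (fun x : ℝ => -((x + α)⁻¹ * (x + α)⁻¹)) (Set.Ioi 0) := by
    have h : ContDiffOn ℝ ∞ (fun x : ℝ => (x + α)⁻¹) (Set.Ioi 0) :=
      ContDiffOn.inv (by fun_prop) (add_ne α hα)
    exact (h.mul h).neg
  refine (ddx_smoothOf _ h fun x hx => ?_).trans rfl
  have h0 := add_ne α hα x hx
  exact (((hasDerivAt_id' x).add_const α).fun_inv h0).congr_deriv (by field_simp)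

/-! ### Formally symmetric operators of order two and four -/

/-- The second order operator `w⁻¹ (d/dx) w p (d/dx) + r`, where `l = w' / w`. -/
def slOp (l p r : SmoothFn) : Module.End ℝ SmoothFn :=
  mulOp p * ddx ^ 2 + mulOp (ddx p + l * p) * ddx + mulOp r

/-- The coefficients of the fourth order operator
`w⁻¹ (d/dx)² w a (d/dx)² + w⁻¹ (d/dx) w g (d/dx) + c`, where `l = w' / w`. -/
def symCoeff (l a g c : SmoothFn) : ℕ → SmoothFn
  | 0 => c
  | 1 => ddx g + l * g
  | 2 => ddx (ddx a) + 2 * l * ddx a + (ddx l + l * l) * a + g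
  | 3 => 2 * (ddx a + l * a)
  | 4 => a
  | _ => 0

/-- The fourth order operator
`w⁻¹ (d/dx)² w a (d/dx)² + w⁻¹ (d/dx) w g (d/dx) + c`, where `l = w' / w`. -/
def symOp (l a g c : SmoothFn) : Module.End ℝ SmoothFn :=
  diffOp 4 (symCoeff l a g c)

theorem slOp_apply (l p r f : SmoothFn) :
    slOp l p r f = p * ddx (ddx f) + (ddx p + l * p) * ddx f + r * f := by
  simp [slOp, mulOp_apply, pow_succ]

theorem diffOp_apply (m : ℕ) (c : ℕ → SmoothFn) (f : SmoothFn) :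
    diffOp m c f = ∑ j ∈ Finset.range (m + 1), c j * (ddx ^ j) f := by
  simp [diffOp, mulOp_apply]

theorem symOp_apply (l a g c f : SmoothFn) :
    symOp l a g c f = a * ddx (ddx (ddx (ddx f))) + 2 * (ddx a + l * a) * ddx (ddx (ddx f))
      + (ddx (ddx a) + 2 * l * ddx a + (ddx l + l * l) * a + g) * ddx (ddx f)
      + (ddx g + l * g) * ddx f + c * f := by
  simp only [symOp, diffOp_apply, Finset.sum_range_succ, Finset.sum_range_zero, symCoeff, pow_succ,
    Module.End.mul_apply, pow_zero, Module.End.one_apply]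
  ring

theorem symOp_add (l a g c a' g' c' : SmoothFn) :
    symOp l a g c + symOp l a' g' c' = symOp l (a + a') (g + g') (c + c') := by
  refine LinearMap.ext fun f => ?_
  simp only [LinearMap.add_apply, symOp_apply, map_add]
  ring

theorem symOp_smul (s : ℝ) (l a g c : SmoothFn) :
    s • symOp l a g c = symOp l (algebraMap ℝ _ s * a) (algebraMap ℝ _ s * g)
      (algebraMap ℝ _ s * c) := by
  refine LinearMap.ext fun f => ?_
  rw [LinearMap.smul_apply, Algebra.smul_def s (symOp l a g c f)]
  simp only [symOp_apply, ddx_mul, ddx_algebraMap, zero_mul, zero_add]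
  ring

theorem slOp_eq_symOp (l p r : SmoothFn) : slOp l p r = symOp l 0 p r := by
  refine LinearMap.ext fun f => ?_
  simp only [slOp_apply, symOp_apply, map_zero]
  ring

theorem one_eq_symOp (l : SmoothFn) : (1 : Module.End ℝ SmoothFn) = symOp l 0 0 1 := by
  refine LinearMap.ext fun f => ?_
  simp only [symOp_apply, map_zero, Module.End.one_apply]
  ring

theorem sq_eq_half_anticomm (A : Module.End ℝ SmoothFn) :
    A ^ 2 = (1 / 2 : ℝ) • (A * A + A * A) := by
  rw [← two_smul ℝ (A * A), smul_smul, pow_two]; norm_num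

/-- The anticommutator of two formally symmetric operators of order two is formally symmetric. -/
theorem slOp_anticomm (l p r s t : SmoothFn) :
    slOp l p r * slOp l s t + slOp l s t * slOp l p r =
      symOp l (2 * (p * s))
        (ddx (ddx (p * s)) - 2 * (ddx p * ddx s) + 2 * (ddx l * (p * s)) + l * ddx (p * s)
          + 2 * (p * t + s * r))
        (slOp l p r t + slOp l s t r) := by
  refine LinearMap.ext fun f => ?_
  simp only [LinearMap.add_apply, Module.End.mul_apply, slOp_apply, symOp_apply, ddx_mul, map_add,
    map_sub, ddx_ofNat, map_zero]
  ring

/-- Conjugation by `h = w^{1/2}` of an operator in symmetric form; `l = h' / h`. -/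
theorem conj_eq_symOp (k h l f₂ f₁ f₀ : SmoothFn) (hkh : k * h = 1) (hh : ddx h = l * h) :
    mulOp k * (ddx ^ 2 * mulOp f₂ * ddx ^ 2 + ddx * mulOp f₁ * ddx + mulOp f₀) * mulOp h =
      symOp (2 * l) f₂ (f₁ + f₂ * (2 * (l * l) + 4 * ddx l) + 2 * (l * ddx f₂))
        (ddx (ddx (f₂ * (ddx l + l * l))) + 2 * (l * ddx (f₂ * (ddx l + l * l)))
          + (ddx l + l * l) * (f₂ * (ddx l + l * l)) + ddx (f₁ * l) + l * (f₁ * l) + f₀) := by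
  refine LinearMap.ext fun f => ?_
  have e : ∀ u : SmoothFn, ddx (h * u) = h * (ddx u + l * u) := fun u => by
    rw [ddx_mul, hh]; ring
  have e' : ∀ u v : SmoothFn, v * (h * u) = h * (v * u) := fun u v => by ring
  simp only [LinearMap.add_apply, Module.End.mul_apply, pow_two, mulOp_apply, symOp_apply, e, e',
    ← mul_add]
  rw [← mul_assoc, mul_comm h k, hkh, one_mul]
  simp only [ddx_mul, map_add, ddx_ofNat]
  ring

/-- A formally symmetric operator determines its three coefficients. -/
theorem symOp_eq_zero {l a g c : SmoothFn} (h : symOp l a g c = 0) : a = 0 ∧ g = 0 ∧ c = 0 := by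
  have key : ∀ f, symOp l a g c f = 0 := fun f => by rw [h]; rfl
  have hc : c = 0 := by simpa [symOp_apply, ddx_one] using key 1
  have d : ∀ r : ℝ, ddx (coordX - algebraMap ℝ _ r) = 1 := fun r => by
    rw [map_sub, ddx_coordX, ddx_algebraMap, sub_zero]
  have ha : a = 0 := by
    refine ev_injective fun x => ?_
    have e := congrArg (ev x) (key ((coordX - algebraMap ℝ _ (x : ℝ)) ^ 4))
    have z : ev x (coordX - algebraMap ℝ _ (x : ℝ)) = 0 := by
      rw [map_sub, AlgHom.commutes]; exact sub_self (x : ℝ)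
    have : ev x a * 24 = 0 := by
      simp only [symOp_apply, pow_succ, pow_zero, one_mul, ddx_mul, d, map_add, map_mul, z, map_one,
        map_zero, ddx_one] at e
      linarith
    rw [map_zero]; linarith
  subst ha hc
  have hg : g = 0 := by
    refine ev_injective fun x => ?_
    have e := congrArg (ev x) (key ((coordX - algebraMap ℝ _ (x : ℝ)) ^ 2))
    have z : ev x (coordX - algebraMap ℝ _ (x : ℝ)) = 0 := by
      rw [map_sub, AlgHom.commutes]; exact sub_self (x : ℝ)
    have : ev x g * 2 = 0 := by
      simp only [symOp_apply, pow_succ, pow_zero, one_mul, ddx_mul, d, map_add, map_mul, z, map_one,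
        map_zero, ddx_one] at e
      linarith
    rw [map_zero]; linarith
  exact ⟨rfl, hg, rfl⟩

/-! ### The symmetric form of `T` -/

/-- The logarithmic derivative `w' / w` of the weight. -/
def logDerivWeight (α : ℝ) (hα : 0 < α) : SmoothFn :=
  algebraMap ℝ _ α * invX - 2 * invU α hα - 1

theorem hasDerivAt_weight (α : ℝ) (hα : 0 < α) {x : ℝ} (hx : 0 < x) :
    HasDerivAt (weight α) (weight α x * (α * x⁻¹ - 2 * (x + α)⁻¹ - 1)) x := by
  have h0 := add_ne α hα x hx
  have h1 : HasDerivAt (fun y : ℝ => Real.exp (-y)) (-Real.exp (-x)) x := by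
    simpa using (hasDerivAt_neg x).exp
  have h2 : HasDerivAt (fun y : ℝ => y ^ α) (α * x ^ (α - 1)) x := by
    simpa using Real.hasDerivAt_rpow_const (p := α) (Or.inl hx.ne')
  have h3 : HasDerivAt (fun y : ℝ => (y + α) ^ 2) (2 * (x + α)) x := by
    simpa using ((hasDerivAt_id' x).add_const α).fun_pow 2
  refine ((h1.mul h2).div h3 (pow_ne_zero 2 h0)).congr_deriv ?_
  rw [Real.rpow_sub_one hx.ne']
  simp only [weight, Pi.mul_apply]
  field_simp
  ring

theorem ddx_weightPow (α : ℝ) (hα : 0 < α) (r : ℝ) :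
    ddx (weightPow α hα r) =
      algebraMap ℝ _ r * logDerivWeight α hα * weightPow α hα r := by
  refine ev_injective fun x => ?_
  have hx : (0 : ℝ) < x := x.2
  have hw := weight_pos α hα x x.2
  have h : HasDerivAt (fun y => weight α y ^ r)
      (ev x (algebraMap ℝ _ r * logDerivWeight α hα * weightPow α hα r)) x := by
    refine ((hasDerivAt_weight α hα hx).rpow_const (p := r) (Or.inl hw.ne')).congr_deriv ?_
    rw [Real.rpow_sub_one hw.ne']
    simp only [logDerivWeight, map_mul, map_sub, AlgHom.commutes, map_ofNat, map_one, invX, invU,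
      weightPow, ev_smoothOf, Algebra.algebraMap_self, RingHom.id_apply]
    field_simp
  rw [ev_apply]
  have e : ext (weightPow α hα r) =ᶠ[nhds (x : ℝ)] fun y => weight α y ^ r := by
    filter_upwards [Ioi_mem_nhds hx] with y hy
    exact ext_smoothOf _ _ hy
  change deriv (ext (weightPow α hα r)) x = _
  rw [e.deriv_eq, h.deriv]

theorem weightPow_mul (α : ℝ) (hα : 0 < α) (r s : ℝ) (h : r + s = 0) :
    weightPow α hα r * weightPow α hα s = 1 := by
  refine ev_injective fun x => ?_
  change weight α x ^ r * weight α x ^ s = 1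
  rw [← Real.rpow_add (weight_pos α hα x x.2), h, Real.rpow_zero]

/-- The leading coefficient of `D_0`. -/
def p0 : SmoothFn := algebraMap ℝ _ (1 / 4) * coordX

/-- The order zero coefficient of `D_0`. -/
def r0 (α : ℝ) (hα : 0 < α) : SmoothFn :=
  algebraMap ℝ _ (1 / 4) * ((algebraMap ℝ _ α + 3 * coordX) * invU α hα)

/-- The leading coefficient of `D_1`. -/
def p1 (α : ℝ) : SmoothFn :=
  algebraMap ℝ _ (1 / 42) * ((algebraMap ℝ _ (3 * α + 10) - coordX) * coordX)

/-- The order zero coefficient of `D_1`. -/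
def r1 (α : ℝ) (hα : 0 < α) : SmoothFn :=
  algebraMap ℝ _ (-1 / 42) * ((algebraMap ℝ _ (α ^ 3 + 5 * α ^ 2 + 10 * α)
    - algebraMap ℝ _ α * (coordX * coordX) - algebraMap ℝ _ (3 * α + 10) * coordX) * invU α hα)

/-- The coefficient of the multiplication operator `D_2`. -/
def r2 (α : ℝ) : SmoothFn := (coordX + algebraMap ℝ _ α) * (coordX + algebraMap ℝ _ α)

theorem D0_eq_slOp (α : ℝ) (hα : 0 < α) :
    D0 α hα = slOp (logDerivWeight α hα) p0 (r0 α hα) := by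
  refine LinearMap.ext fun f => ev_injective fun x => ?_
  have hx : (x : ℝ) ≠ 0 := ne_of_gt x.2
  have hu := add_ne α hα x x.2
  simp only [D0, slOp_apply, LinearMap.add_apply, Module.End.mul_apply,
    mulOp_apply, pow_two, logDerivWeight, p0, r0, ddx_mul, ddx_algebraMap, ddx_coordX]
  simp only [map_mul, map_sub, map_add, map_zero, map_one, map_ofNat, AlgHom.commutes,
    Algebra.algebraMap_self, RingHom.id_apply, coordX, invX, invU, ev_smoothOf]
  field_simp
  ring

theorem D1_eq_slOp (α : ℝ) (hα : 0 < α) :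
    D1 α hα = slOp (logDerivWeight α hα) (p1 α) (r1 α hα) := by
  refine LinearMap.ext fun f => ev_injective fun x => ?_
  have hx : (x : ℝ) ≠ 0 := ne_of_gt x.2
  have hu := add_ne α hα x x.2
  simp only [D1, slOp_apply, LinearMap.add_apply, LinearMap.sub_apply, Module.End.mul_apply,
    mulOp_apply, pow_two, logDerivWeight, p1, r1, ddx_mul, ddx_algebraMap, ddx_coordX,
    LinearMap.map_sub]
  simp only [map_mul, map_sub, map_add, map_zero, map_one, map_ofNat, AlgHom.commutes,
    Algebra.algebraMap_self, RingHom.id_apply, coordX, invX, invU, ev_smoothOf]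
  field_simp
  ring

theorem D2_eq_slOp (α : ℝ) (hα : 0 < α) :
    D2 α = slOp (logDerivWeight α hα) 0 (r2 α) := by
  refine LinearMap.ext fun f => ?_
  have h : smoothOf (fun x => (x + α) ^ 2) (by fun_prop) = r2 α :=
    ev_injective fun x => pow_two ((x : ℝ) + α)
  rw [D2, h]
  simp only [slOp_apply, map_zero, zero_mul, mul_zero, zero_add]
  rfl

/-- The coefficient of `w⁻¹ (d/dx) w g (d/dx)` in the formally symmetric form of `T`. -/
def gT (α : ℝ) (hα : 0 < α) (Ω N : ℝ) : SmoothFn :=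
  let l := algebraMap ℝ _ (1 / 2) * logDerivWeight α hα
  f1 α hα Ω N + f2 Ω * (2 * (l * l) + 4 * ddx l) + 2 * (l * ddx (f2 Ω))

/-- The order zero coefficient in the formally symmetric form of `T`. -/
def cT (α : ℝ) (hα : 0 < α) (Ω N : ℝ) : SmoothFn :=
  let l := algebraMap ℝ _ (1 / 2) * logDerivWeight α hα
  ddx (ddx (f2 Ω * (ddx l + l * l))) + 2 * (l * ddx (f2 Ω * (ddx l + l * l)))
    + (ddx l + l * l) * (f2 Ω * (ddx l + l * l)) + ddx (f1 α hα Ω N * l)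
    + l * (f1 α hα Ω N * l) + f0 α hα Ω N

/-- The operator `w^{-1/2} (∑ ∂^k f_k ∂^k) w^{1/2}` in formally symmetric form. -/
theorem conj_eq_symOp_gT (α : ℝ) (hα : 0 < α) (Ω N : ℝ) :
    mulOp (weightPow α hα (-1 / 2)) *
          (ddx ^ 2 * mulOp (f2 Ω) * ddx ^ 2 + ddx * mulOp (f1 α hα Ω N) * ddx +
            mulOp (f0 α hα Ω N)) * mulOp (weightPow α hα (1 / 2)) =
      symOp (logDerivWeight α hα) (f2 Ω) (gT α hα Ω N) (cT α hα Ω N) := by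
  rw [conj_eq_symOp _ _ (algebraMap ℝ _ (1 / 2) * logDerivWeight α hα) _ _ _
    (weightPow_mul α hα _ _ (by norm_num)) (ddx_weightPow α hα _)]
  congr 1
  rw [← mul_assoc, ← map_ofNat (algebraMap ℝ SmoothFn) 2, ← map_mul]
  norm_num

theorem f2_eq (Ω : ℝ) :
    f2 Ω = (algebraMap ℝ _ Ω - coordX) * (algebraMap ℝ _ Ω - coordX) * (coordX * coordX) := by
  refine ev_injective fun x => ?_
  simp only [f2, map_mul, map_sub, AlgHom.commutes, Algebra.algebraMap_self,
    RingHom.id_apply, coordX, ev_smoothOf]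
  ring

/-- The coefficient `f_1` as an expression in `x` and `1 / (x + α)`, in which it can be
differentiated. -/
theorem f1_eq (α : ℝ) (hα : 0 < α) (Ω N : ℝ) :
    f1 α hα Ω N = (algebraMap ℝ _ Ω - coordX) *
      (algebraMap ℝ _ (-Ω / 2) * (coordX + algebraMap ℝ _ α) ^ 2
        + algebraMap ℝ _ (1 / 2) * (coordX * (coordX + algebraMap ℝ _ α)
          * (coordX - algebraMap ℝ _ (3 * α)))
        - algebraMap ℝ _ (2 * N) * (coordX * (coordX + algebraMap ℝ _ α))
        + (algebraMap ℝ _ (2 * Ω) * (coordX * (algebraMap ℝ _ α - coordX))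
          - 2 * (coordX * (coordX ^ 2 + algebraMap ℝ _ (4 * α) * coordX + algebraMap ℝ _ (α ^ 2))))
          * (invU α hα * invU α hα)) := by
  refine ev_injective fun x => ?_
  have hu := add_ne α hα x x.2
  simp only [f1, map_mul, map_sub, map_pow,
    map_add, map_ofNat, AlgHom.commutes, Algebra.algebraMap_self,
    RingHom.id_apply, coordX, invU, ev_smoothOf]
  field_simp
  ring

set_option maxHeartbeats 4000000 in
/-- `T` is a linear combination of formally symmetric operators; the three coefficients of the
symmetric form are compared as rational functions of `x`. -/
theorem T_eq_symOp (α : ℝ) (hα : 0 < α) (Ω N : ℝ) :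
    T α hα Ω N = symOp (logDerivWeight α hα) (f2 Ω) (gT α hα Ω N) (cT α hα Ω N) := by
  rw [T, sq_eq_half_anticomm, sq_eq_half_anticomm, D0_eq_slOp, D1_eq_slOp, D2_eq_slOp α hα]
  simp only [slOp_anticomm, slOp_apply]
  simp only [slOp_eq_symOp, symOp_smul, symOp_add]
  congr 1
  · refine ev_injective fun x => ?_
    simp only [f2_eq, p0, p1, map_mul, map_sub, map_zero,
      map_add, map_ofNat, AlgHom.commutes, Algebra.algebraMap_self,
      RingHom.id_apply, coordX, ev_smoothOf]
    ring
  · refine ev_injective fun x => ?_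
    have hx : (x : ℝ) ≠ 0 := ne_of_gt x.2
    have hu := add_ne α hα x x.2
    simp only [gT, f2_eq, f1_eq, p0, p1, r0, r1, r2, pow_succ, pow_zero, one_mul, logDerivWeight,
      ddx_mul, ddx_algebraMap, ddx_coordX, LinearMap.map_add, LinearMap.map_sub,
      LinearMap.map_zero,
      ddx_invX, ddx_invU, ddx_one, ddx_ofNat]
    simp only [map_mul, map_sub, map_neg,
      map_add, map_zero, map_one, map_ofNat, AlgHom.commutes, Algebra.algebraMap_self,
      RingHom.id_apply, coordX, invX, invU, ev_smoothOf]
    field_simp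
    ring
  · refine ev_injective fun x => ?_
    have hx : (x : ℝ) ≠ 0 := ne_of_gt x.2
    have hu := add_ne α hα x x.2
    simp only [cT, f2_eq, f1_eq, p0, p1, r0, r1, r2, pow_succ, pow_zero, one_mul, logDerivWeight,
      ddx_mul, ddx_algebraMap, ddx_coordX, LinearMap.map_add, LinearMap.map_sub, LinearMap.map_neg,
      LinearMap.map_zero,
      ddx_invX, ddx_invU, ddx_one, ddx_ofNat]
    simp only [map_mul, map_sub, map_neg,
      map_add, map_zero, map_one, map_ofNat, AlgHom.commutes, Algebra.algebraMap_self,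
      RingHom.id_apply, f0, f0Fun, coordX, invX, invU, ev_smoothOf]
    field_simp
    ring

/-! ### Linear independence of the eight operators -/

theorem Y_eq_symOp (α : ℝ) (hα : 0 < α) (i : Fin 8) :
    ∃ a g c, Y α hα i = symOp (logDerivWeight α hα) a g c := by
  fin_cases i <;>
    simp only [Y, Matrix.cons_val, Fin.reduceFinMk, Fin.zero_eta, Fin.isValue, Fin.mk_one,
      one_eq_symOp (logDerivWeight α hα), sq_eq_half_anticomm, D0_eq_slOp, D1_eq_slOp,
      D2_eq_slOp α hα, slOp_anticomm] <;>
    (try simp only [slOp_eq_symOp, symOp_smul]) <;>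
    exact ⟨_, _, _, rfl⟩

/-- Comparing the coefficients of the symmetric forms reduces linear independence to that of
`x²`, `x² t²`, `x² t`, then of `x`, `x t`, `x (x + α)²`, then of `1`, `(x + α)²`, where
`t = 3 α + 10 - x`. -/
theorem sum_smul_Y_eq_zero (α : ℝ) (hα : 0 < α) (s : Fin 8 → ℝ)
    (h : ∑ i, s i • Y α hα i = 0) (i : Fin 8) : s i = 0 := by
  simp only [Fin.sum_univ_eight, Y, Matrix.cons_val, Fin.isValue,
      one_eq_symOp (logDerivWeight α hα), sq_eq_half_anticomm, D0_eq_slOp, D1_eq_slOp,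
      D2_eq_slOp α hα, slOp_anticomm] at h
  simp only [slOp_eq_symOp, symOp_smul, symOp_add] at h
  obtain ⟨ha, hg, hc⟩ := symOp_eq_zero h
  have ea : ∀ x : ℝ, 0 < x →
      x ^ 2 * (s 4 / 16 + s 5 * (3 * α + 10 - x) ^ 2 / 1764 + s 6 * (3 * α + 10 - x) / 84) = 0 := by
    intro x hx
    have e := congrArg (ev ⟨x, hx⟩) ha
    simp only [p0, p1, map_mul, map_sub, map_zero, map_add, map_ofNat, AlgHom.commutes,
      Algebra.algebraMap_self, RingHom.id_apply, coordX, ev_smoothOf] at e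
    rw [← e]
    ring
  have ea' : ∀ x : ℝ, 0 < x →
      s 4 / 16 + s 5 * (3 * α + 10 - x) ^ 2 / 1764 + s 6 * (3 * α + 10 - x) / 84 = 0 :=
    fun x hx => (mul_eq_zero.1 (ea x hx)).resolve_left (by positivity)
  have h1 := ea' (3 * α + 10) (by positivity)
  have h2 := ea' (3 * α + 9) (by positivity)
  have h3 := ea' (3 * α + 11) (by positivity)
  have s4 : s 4 = 0 := by linarith
  have s5 : s 5 = 0 := by linarith
  have s6 : s 6 = 0 := by linarith
  have eg : ∀ x : ℝ, 0 < x →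
      x * (s 1 / 4 + s 2 * (3 * α + 10 - x) / 42 + s 7 * (x + α) ^ 2 / 2) = 0 := by
    intro x hx
    have e := congrArg (ev ⟨x, hx⟩) hg
    simp only [s4, s5, s6, p0, p1, r2, zero_mul, mul_zero, map_mul, map_sub, map_zero,
      map_add, map_ofNat, AlgHom.commutes,
      Algebra.algebraMap_self, RingHom.id_apply, coordX, ev_smoothOf] at e
    rw [← e]
    ring
  have eg' : ∀ x : ℝ, 0 < x →
      s 1 / 4 + s 2 * (3 * α + 10 - x) / 42 + s 7 * (x + α) ^ 2 / 2 = 0 :=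
    fun x hx => (mul_eq_zero.1 (eg x hx)).resolve_left hx.ne'
  have h1 := eg' 1 (by norm_num)
  have h2 := eg' 2 (by norm_num)
  have h3 := eg' 3 (by norm_num)
  have s7 : s 7 = 0 := by nlinarith
  have s2 : s 2 = 0 := by rw [s7] at h1 h2; linarith
  have s1 : s 1 = 0 := by rw [s7, s2] at h1; linarith
  have ec : ∀ x : ℝ, 0 < x → s 0 + s 3 * (x + α) ^ 2 = 0 := by
    intro x hx
    have e := congrArg (ev ⟨x, hx⟩) hc
    simp only [s1, s2, s4, s5, s6, s7, r2, zero_mul, map_mul, map_zero,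
      map_add, map_one, AlgHom.commutes,
      Algebra.algebraMap_self, RingHom.id_apply, coordX, ev_smoothOf] at e
    rw [← e]
    ring
  have h1 := ec 1 (by norm_num)
  have h2 := ec 2 (by norm_num)
  have s3 : s 3 = 0 := by
    have : s 3 * (3 + 2 * α) = 0 := by linear_combination h2 - h1
    exact (mul_eq_zero.1 this).resolve_right (by positivity)
  have s0 : s 0 = 0 := by rw [s3] at h1; linarith
  fin_cases i <;> assumption

theorem linearIndependent_Y (α : ℝ) (hα : 0 < α) : LinearIndependent ℝ (Y α hα) := by
  rw [Fintype.linearIndependent_iffₛ]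
  intro s t h i
  refine sub_eq_zero.1 (sum_smul_Y_eq_zero α hα (s - t) ?_ i)
  refine LinearMap.ext fun f => ?_
  have hf := LinearMap.congr_fun h f
  simp only [LinearMap.sum_apply, LinearMap.smul_apply] at hf ⊢
  simp only [Pi.sub_apply, sub_smul, Finset.sum_sub_distrib, hf, sub_self, LinearMap.zero_apply]

/-! ### Relations between classical Laguerre polynomials -/

theorem laguerre_coeff (a : ℝ) (m k : ℕ) :
    (laguerre a m).coeff k = if k ≤ m then (-1) ^ k * (ascPochhammer ℝ (m - k)).eval (a + k + 1)
      / ((m - k).factorial * k.factorial) else 0 := by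
  simp only [laguerre, finsetSum_coeff, coeff_C_mul, coeff_X_pow, mul_ite, mul_one, mul_zero]
  rw [Finset.sum_ite_eq]
  simp

theorem laguerre_coeff_add (a : ℝ) (j k : ℕ) :
    (laguerre a (j + k)).coeff k = (-1) ^ k * (ascPochhammer ℝ j).eval (a + k + 1)
      / (j.factorial * k.factorial) := by
  rw [laguerre_coeff, if_pos (Nat.le_add_left k j), Nat.add_sub_cancel]

theorem laguerre_coeff_of_lt (a : ℝ) {m k : ℕ} (h : m < k) : (laguerre a m).coeff k = 0 := by
  rw [laguerre_coeff, if_neg (not_le.2 h)]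

theorem eval_ascPochhammer_succ_left (j : ℕ) (b : ℝ) :
    (ascPochhammer ℝ (j + 1)).eval b = b * (ascPochhammer ℝ j).eval (b + 1) := by
  rw [ascPochhammer_succ_left, eval_mul, eval_comp]
  simp

theorem laguerre_zero (a : ℝ) : laguerre a 0 = 1 := by
  simp [laguerre]

theorem derivative_laguerre_succ (a : ℝ) (m : ℕ) :
    derivative (laguerre a (m + 1)) = -laguerre (a + 1) m := by
  ext k
  rw [coeff_derivative, coeff_neg]
  rcases lt_or_ge m k with h | h
  · rw [laguerre_coeff_of_lt _ h, laguerre_coeff_of_lt _ (by omega)]; simp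
  · obtain ⟨j, rfl⟩ := Nat.exists_eq_add_of_le' h
    rw [add_assoc, laguerre_coeff_add, laguerre_coeff_add, Nat.factorial_succ k]
    push_cast
    rw [show a + ((k : ℝ) + 1) + 1 = a + 1 + k + 1 by ring]
    have : (k.factorial : ℝ) ≠ 0 := by positivity
    field_simp
    ring

theorem laguerre_succ_succ (a : ℝ) (m : ℕ) :
    laguerre (a + 1) (m + 1) = laguerre (a + 1) m + laguerre a (m + 1) := by
  ext k
  rw [coeff_add]
  rcases lt_trichotomy k (m + 1) with h | rfl | h
  · obtain ⟨j, rfl⟩ := Nat.exists_eq_add_of_le' (Nat.lt_succ_iff.1 h)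
    rw [show j + k + 1 = (j + 1) + k by ring, laguerre_coeff_add, laguerre_coeff_add,
      laguerre_coeff_add, eval_ascPochhammer_succ_left j (a + k + 1), ascPochhammer_succ_eval,
      Nat.factorial_succ j]
    push_cast
    rw [show a + 1 + (k : ℝ) + 1 = a + k + 1 + 1 by ring]
    have : (k.factorial : ℝ) ≠ 0 := by positivity
    have : (j.factorial : ℝ) ≠ 0 := by positivity
    field_simp
    ring
  · rw [laguerre_coeff_of_lt _ (Nat.lt_succ_self m)]
    simp [laguerre_coeff]
  · rw [laguerre_coeff_of_lt _ (by omega), laguerre_coeff_of_lt _ (by omega),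
      laguerre_coeff_of_lt _ h, add_zero]

/-- The Rodrigues-type recursion `(m+1) x^a e^{-x} L_{m+1}^{(a)} = (x^{a+1} e^{-x} L_m^{(a+1)})'`.
-/
theorem laguerre_succ_rodrigues (a : ℝ) (m : ℕ) :
    C ((m : ℝ) + 1) * laguerre a (m + 1) =
      X * derivative (laguerre (a + 1) m) + C (a + 1) * laguerre (a + 1) m
        - X * laguerre (a + 1) m := by
  ext k
  rw [coeff_sub, coeff_add, coeff_C_mul, coeff_C_mul]
  rcases k with _ | k
  · rw [mul_coeff_zero, mul_coeff_zero, coeff_X_zero, zero_mul, zero_mul]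
    have h1 := laguerre_coeff_add a (m + 1) 0
    have h2 := laguerre_coeff_add (a + 1) m 0
    simp only [add_zero] at h1 h2
    rw [h1, h2, eval_ascPochhammer_succ_left, Nat.factorial_succ]
    push_cast
    have : (m.factorial : ℝ) ≠ 0 := by positivity
    field_simp
    ring_nf
  · rw [coeff_X_mul, coeff_X_mul, coeff_derivative]
    rcases lt_trichotomy k m with h | rfl | h
    · obtain ⟨j, hj⟩ := Nat.exists_eq_add_of_le' (Nat.succ_le_of_lt h)
      have e1 := laguerre_coeff_add a (j + 1) (k + 1)
      have e2 := laguerre_coeff_add (a + 1) j (k + 1)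
      have e3 := laguerre_coeff_add (a + 1) (j + 1) k
      rw [show j + 1 + (k + 1) = m + 1 by omega] at e1
      rw [show j + (k + 1) = m by omega] at e2
      rw [show j + 1 + k = m by omega] at e3
      have hm : (m : ℝ) = j + k + 1 := by rw [hj]; push_cast; ring
      rw [e1, e2, e3, eval_ascPochhammer_succ_left, eval_ascPochhammer_succ_left,
        Nat.factorial_succ, Nat.factorial_succ, hm]
      push_cast
      rw [show a + ((k : ℝ) + 1) + 1 = a + k + 2 by ring,
        show a + 1 + ((k : ℝ) + 1) + 1 = a + k + 3 by ring,
        show a + (k : ℝ) + 2 + 1 = a + k + 3 by ring,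
        show a + 1 + (k : ℝ) + 1 + 1 = a + k + 3 by ring,
        show a + 1 + (k : ℝ) + 1 = a + k + 2 by ring]
      have : (k.factorial : ℝ) ≠ 0 := by positivity
      have : (j.factorial : ℝ) ≠ 0 := by positivity
      field_simp
      ring
    · rw [laguerre_coeff_of_lt _ (Nat.lt_succ_self k)]
      have e1 := laguerre_coeff_add a 0 (k + 1)
      have e2 := laguerre_coeff_add (a + 1) 0 k
      simp only [zero_add] at e1 e2
      rw [e1, e2, Nat.factorial_succ]
      push_cast
      have : (k.factorial : ℝ) ≠ 0 := by positivity
      simp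
      field_simp
      ring
    · rw [laguerre_coeff_of_lt _ h, laguerre_coeff_of_lt _ (by omega),
        laguerre_coeff_of_lt _ (by omega)]
      ring

theorem laguerre_add_one_eq_sub (a : ℝ) (m : ℕ) :
    laguerre (a + 1) m = laguerre a m - derivative (laguerre a m) := by
  rcases m with _ | m
  · simp [laguerre_zero]
  · rw [derivative_laguerre_succ, laguerre_succ_succ]; ring

theorem derivative_laguerre_succ' (a : ℝ) (m : ℕ) :
    derivative (laguerre a (m + 1)) = derivative (laguerre a m) - laguerre a m := by
  rw [derivative_laguerre_succ, laguerre_add_one_eq_sub]; ring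

/-- Laguerre's differential equation. -/
theorem laguerre_ode (a : ℝ) (m : ℕ) :
    X * derivative (derivative (laguerre a m)) + (C (a + 1) - X) * derivative (laguerre a m)
      + C (m : ℝ) * laguerre a m = 0 := by
  rcases m with _ | m
  · simp [laguerre_zero]
  · have h := laguerre_succ_rodrigues a m
    rw [← neg_neg (laguerre (a + 1) m), ← derivative_laguerre_succ, derivative_neg] at h
    push_cast
    rw [h]
    ring

theorem laguerre_raise (a : ℝ) (m : ℕ) :
    C ((m : ℝ) + 1) * laguerre a (m + 1) =
      X * derivative (laguerre a m) + (C (m + a + 1) - X) * laguerre a m := by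
  rw [laguerre_succ_rodrigues, laguerre_add_one_eq_sub, derivative_sub]
  have h := laguerre_ode a m
  simp only [C_add] at h ⊢
  linear_combination -h

/-! ### Exceptional Laguerre polynomials as Darboux transforms of classical ones -/

/-- The first order operator `p ↦ (x + α) p' - (x + α + 1) p` which maps classical to exceptional
Laguerre polynomials. -/
def darboux (α : ℝ) (p : ℝ[X]) : ℝ[X] := (X + C α) * derivative p - (X + C α + 1) * p

/-- The normalization factor of the exceptional Laguerre polynomial of degree `m + 1`. -/
def normFactor (α : ℝ) (m : ℕ) : ℝ :=
  √((α + m) * m.factorial / ((α + m + 1) * Real.Gamma (m + 1 + α)))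

theorem xLaguerre_zero (α : ℝ) : xLaguerre α 0 = 0 := by
  have h1 : laguerreZ α (((0 : ℕ) : ℤ) - 1) = 0 := rfl
  have h2 : laguerreZ α (((0 : ℕ) : ℤ) - 2) = 0 := rfl
  rw [xLaguerre, h1, h2]
  ring

/-- The exceptional Laguerre polynomials of parameter `α` come from the classical ones of parameter
`α - 1`. -/
theorem xLaguerre_succ (α : ℝ) (m : ℕ) :
    xLaguerre α (m + 1) = C (normFactor α m) * darboux α (laguerre (α - 1) m) := by
  have h0 : laguerreZ α (((m + 1 : ℕ) : ℤ) - 1) = laguerre α m := by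
    rw [show (((m + 1 : ℕ) : ℤ) - 1) = ((m : ℕ) : ℤ) by push_cast; ring]; rfl
  have h1 : laguerreZ α (((m + 1 : ℕ) : ℤ) - 2) = -derivative (laguerre (α - 1) m) := by
    rcases m with _ | m
    · rw [laguerre_zero, derivative_one, neg_zero]; rfl
    · rw [show (((m + 1 + 1 : ℕ) : ℤ) - 2) = ((m : ℕ) : ℤ) by push_cast; ring,
        derivative_laguerre_succ, neg_neg, sub_add_cancel]
      rfl
  have h2 := laguerre_add_one_eq_sub (α - 1) m
  rw [sub_add_cancel] at h2
  rw [xLaguerre, h0, h1, h2, normFactor, darboux]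
  congr 1
  · simp only [Nat.cast_add, Nat.cast_one, Nat.add_sub_cancel]
    congr 3
    · ring
    · ring
  · ring

theorem normFactor_pos (α : ℝ) (hα : 0 < α) (m : ℕ) : 0 < normFactor α m := by
  have : 0 < Real.Gamma (m + 1 + α) := Real.Gamma_pos_of_pos (by positivity)
  exact Real.sqrt_pos.2 (by positivity)

/-- The ratio of consecutive normalization factors. The square roots in the entries of `L_1` and
`L_2` turn one factor into the other, with a rational coefficient; this is the content of the lemmas
`normFactor_raise` to `normFactor_lower_two`. -/
theorem normFactor_succ (α : ℝ) (hα : 0 < α) (m : ℕ) :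
    √(α + m + 2) * √(α + m) * normFactor α (m + 1) =
      √(α + m + 1) * √((m : ℝ) + 1) * normFactor α m := by
  have hΓ : 0 < Real.Gamma (m + 1 + α) := Real.Gamma_pos_of_pos (by positivity)
  have hΓ' : Real.Gamma ((m + 1 : ℕ) + 1 + α) = (m + 1 + α) * Real.Gamma (m + 1 + α) := by
    rw [← Real.Gamma_add_one (by positivity)]
    push_cast
    ring_nf
  rw [normFactor, normFactor, hΓ', ← Real.sqrt_mul (by positivity), ← Real.sqrt_mul (by positivity),
    ← Real.sqrt_mul (by positivity), ← Real.sqrt_mul (by positivity), Nat.factorial_succ]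
  congr 1
  push_cast
  have h2 : α + m + 1 ≠ 0 := by positivity
  have h3 : (m : ℝ) + 1 + α ≠ 0 := by positivity
  have h4 : α + (m + 1) + 1 ≠ 0 := by positivity
  field_simp
  ring

theorem normFactor_raise (α : ℝ) (hα : 0 < α) (m : ℕ) :
    √(α + m + 2) * √(α + m + 1) * √(α + m) * √((m : ℝ) + 1) * normFactor α (m + 1) =
      (α + m + 1) * (m + 1) * normFactor α m := by
  have h1 := Real.mul_self_sqrt (show 0 ≤ α + m + 1 by positivity)
  have h2 := Real.mul_self_sqrt (show 0 ≤ (m : ℝ) + 1 by positivity)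
  have h := normFactor_succ α hα m
  generalize √(α + m + 1) = A at *
  generalize √((m : ℝ) + 1) = B at *
  rw [← h1, ← h2]
  linear_combination A * B * h

theorem normFactor_lower (α : ℝ) (hα : 0 < α) (m : ℕ) :
    √(α + m + 2) * √(α + m + 1) * √(α + m) * √((m : ℝ) + 1) * normFactor α m =
      (α + m + 2) * (α + m) * normFactor α (m + 1) := by
  have h1 := Real.mul_self_sqrt (show 0 ≤ α + m + 2 by positivity)
  have h2 := Real.mul_self_sqrt (show 0 ≤ α + m by positivity)
  have h := normFactor_succ α hα m
  generalize √(α + m + 2) = A at *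
  generalize √(α + m) = B at *
  linear_combination -A * B * h + B * B * normFactor α (m + 1) * h1
    + (α + m + 2) * normFactor α (m + 1) * h2

theorem normFactor_succ_succ (α : ℝ) (hα : 0 < α) (m : ℕ) :
    √(α + m + 3) * √(α + m) * normFactor α (m + 2) =
      √((m : ℝ) + 1) * √((m : ℝ) + 2) * normFactor α m := by
  have h := normFactor_succ α hα m
  have h' := normFactor_succ α hα (m + 1)
  push_cast at h'
  rw [show α + ((m : ℝ) + 1) + 2 = α + m + 3 by ring, show α + ((m : ℝ) + 1) = α + m + 1 by ring,
    show α + (m : ℝ) + 1 + 1 = α + m + 2 by ring, show (m : ℝ) + 1 + 1 = m + 2 by ring] at h'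
  have h1 : √(α + m + 1) ≠ 0 := (Real.sqrt_pos.2 (by positivity)).ne'
  refine mul_left_cancel₀ h1 ?_
  linear_combination √(α + m) * h' + √((m : ℝ) + 2) * h

theorem normFactor_raise_two (α : ℝ) (hα : 0 < α) (m : ℕ) :
    √(α + m + 3) * √(α + m) * √((m : ℝ) + 2) * √((m : ℝ) + 1) * normFactor α (m + 2) =
      (m + 1) * (m + 2) * normFactor α m := by
  have h1 := Real.mul_self_sqrt (show 0 ≤ (m : ℝ) + 1 by positivity)
  have h2 := Real.mul_self_sqrt (show 0 ≤ (m : ℝ) + 2 by positivity)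
  have h := normFactor_succ_succ α hα m
  generalize √((m : ℝ) + 1) = A at *
  generalize √((m : ℝ) + 2) = B at *
  rw [← h1, ← h2]
  linear_combination A * B * h

theorem normFactor_lower_two (α : ℝ) (hα : 0 < α) (m : ℕ) :
    √(α + m + 3) * √(α + m) * √((m : ℝ) + 2) * √((m : ℝ) + 1) * normFactor α m =
      (α + m + 3) * (α + m) * normFactor α (m + 2) := by
  have h1 := Real.mul_self_sqrt (show 0 ≤ α + m + 3 by positivity)
  have h2 := Real.mul_self_sqrt (show 0 ≤ α + m by positivity)
  have h := normFactor_succ_succ α hα m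
  generalize √(α + m + 3) = A at *
  generalize √(α + m) = B at *
  rw [← h1, ← h2]
  linear_combination -A * B * h

theorem darboux_eval (α x : ℝ) (p : ℝ[X]) :
    (darboux α p).eval x = (x + α) * (derivative p).eval x - (x + α + 1) * p.eval x := by
  simp [darboux]

theorem laguerre_raise_eval (α : ℝ) (m : ℕ) (x : ℝ) :
    (m + 1) * (laguerre (α - 1) (m + 1)).eval x =
      x * (derivative (laguerre (α - 1) m)).eval x + (m + α - x) * (laguerre (α - 1) m).eval x := by
  have h := congrArg (eval x) (laguerre_raise (α - 1) m)
  simp only [eval_mul, eval_add, eval_sub, eval_C, eval_X] at h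
  rw [h]; ring

theorem derivative_laguerre_succ_eval (α : ℝ) (m : ℕ) (x : ℝ) :
    (derivative (laguerre (α - 1) (m + 1))).eval x =
      (derivative (laguerre (α - 1) m)).eval x - (laguerre (α - 1) m).eval x := by
  rw [derivative_laguerre_succ', eval_sub]

/-- The transform of `L_{m+1}^{(α-1)}` in terms of `L_m^{(α-1)}` and its derivative. -/
theorem darboux_laguerre_raise (α : ℝ) (m : ℕ) (x : ℝ) :
    (m + 1) * (darboux α (laguerre (α - 1) (m + 1))).eval x =
      (x + α) * (m + 1) * ((derivative (laguerre (α - 1) m)).eval x - (laguerre (α - 1) m).eval x)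
        - (x + α + 1) * (x * (derivative (laguerre (α - 1) m)).eval x
          + (m + α - x) * (laguerre (α - 1) m).eval x) := by
  rw [darboux_eval, derivative_laguerre_succ_eval]
  linear_combination -(x + α + 1) * laguerre_raise_eval α m x

theorem darboux_laguerre_raise_two (α : ℝ) (m : ℕ) (x : ℝ) :
    (m + 1) * (m + 2) * (darboux α (laguerre (α - 1) (m + 2))).eval x =
      (x + α) * (m + 2) * ((m + 1) * ((derivative (laguerre (α - 1) m)).eval x
          - (laguerre (α - 1) m).eval x) - (x * (derivative (laguerre (α - 1) m)).eval x
          + (m + α - x) * (laguerre (α - 1) m).eval x))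
        - (x + α + 1) * (x * ((m + 1) * ((derivative (laguerre (α - 1) m)).eval x
          - (laguerre (α - 1) m).eval x)) + (m + 1 + α - x) *
            (x * (derivative (laguerre (α - 1) m)).eval x
          + (m + α - x) * (laguerre (α - 1) m).eval x)) := by
  have h := darboux_laguerre_raise α (m + 1) x
  rw [derivative_laguerre_succ_eval] at h
  push_cast at h
  linear_combination ((m : ℝ) + 1) * h
    - ((x + α) * (m + 2) + (x + α + 1) * (m + 1 + α - x)) * laguerre_raise_eval α m x

/-- The transform of `L_m^{(α-1)}` in terms of `L_{m+1}^{(α-1)}` and its derivative. -/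
theorem darboux_laguerre_lower (α : ℝ) (m : ℕ) (x : ℝ) :
    (α + m) * (darboux α (laguerre (α - 1) m)).eval x =
      ((x + α) * (α + m) + x) * (derivative (laguerre (α - 1) (m + 1))).eval x
        - (m + 1) * (laguerre (α - 1) (m + 1)).eval x := by
  rw [darboux_eval, laguerre_raise_eval, derivative_laguerre_succ_eval]
  ring

theorem darboux_laguerre_lower_two (α : ℝ) (m : ℕ) (x : ℝ) :
    (α + m) * (darboux α (laguerre (α - 1) m)).eval x =
      ((x + α) * (α + m) + x) * (derivative (laguerre (α - 1) (m + 2))).eval x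
        + (x + α - 1) * ((m + 2) * (laguerre (α - 1) (m + 2)).eval x
          - x * (derivative (laguerre (α - 1) (m + 2))).eval x) := by
  have h := laguerre_raise_eval α (m + 1) x
  push_cast at h
  rw [darboux_laguerre_lower, derivative_laguerre_succ_eval α (m + 1)]
  linear_combination -(x + α - 1) * h

theorem laguerre_ode_eval (α : ℝ) (m : ℕ) (x : ℝ) :
    x * (derivative (derivative (laguerre (α - 1) m))).eval x
      + (α - x) * (derivative (laguerre (α - 1) m)).eval x
      + m * (laguerre (α - 1) m).eval x = 0 := by
  have h := congrArg (eval x) (laguerre_ode (α - 1) m)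
  simp only [eval_mul, eval_add, eval_sub, eval_C, eval_X, eval_zero, sub_add_cancel] at h
  exact h

theorem derivative_laguerre_ode_eval (α : ℝ) (m : ℕ) (x : ℝ) :
    x * (derivative (derivative (derivative (laguerre (α - 1) m)))).eval x
      + (α + 1 - x) * (derivative (derivative (laguerre (α - 1) m))).eval x
      + (m - 1) * (derivative (laguerre (α - 1) m)).eval x = 0 := by
  have h := congrArg (fun p => eval x (derivative p)) (laguerre_ode (α - 1) m)
  simp only [derivative_add, derivative_mul, derivative_sub, derivative_C, derivative_X,
    eval_mul, eval_add, eval_sub, eval_C, eval_X, eval_zero, sub_add_cancel, derivative_zero] at h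
  simp only [eval_one] at h
  linear_combination h

/-! ### The difference operators `L_0`, `L_1`, `L_2` -/

/-- Polynomials as smooth functions on `(0, ∞)`. -/
def polyFn (p : ℝ[X]) : SmoothFn :=
  smoothOf (fun x => p.eval x) (by simpa using (p.contDiff_aeval (𝕜 := ℝ) ∞).contDiffOn)

theorem ddx_polyFn (p : ℝ[X]) : ddx (polyFn p) = polyFn (derivative p) :=
  ddx_smoothOf _ _ fun x _ => p.hasDerivAt x

theorem qfun_eq_polyFn (α : ℝ) (n : ℕ) : qfun α n = polyFn (xLaguerre α n) := rfl

theorem ev_polyFn (x : Set.Ioi (0 : ℝ)) (p : ℝ[X]) : ev x (polyFn p) = p.eval (x : ℝ) := rfl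

theorem qfun_zero (α : ℝ) : qfun α 0 = 0 := by
  refine ev_injective fun x => ?_
  rw [qfun_eq_polyFn, ev_polyFn, xLaguerre_zero, eval_zero, map_zero]

theorem ev_bandAct (k : ℕ) (L : Matrix ℕ ℕ ℝ) (α : ℝ) (n : ℕ) (x : Set.Ioi (0 : ℝ)) :
    ev x (bandAct k L (qfun α) n) =
      ∑ j ∈ Finset.range (n + k + 1), L n j * (xLaguerre α j).eval (x : ℝ) := by
  rw [bandAct, map_sum]
  refine Finset.sum_congr rfl fun j _ => ?_
  rw [map_smul]
  rfl

theorem isSymmBand_L0 : IsSymmBand 0 L0 := by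
  refine ⟨Matrix.IsSymm.ext fun i j => ?_, fun i j h => if_neg (by omega)⟩
  rcases eq_or_ne i j with rfl | h
  · rfl
  · rw [L0, L0, if_neg h, if_neg h.symm]

theorem L1_succ (α : ℝ) (n : ℕ) :
    L1 α n (n + 1) = -(√(α + n + 1) * √(α + n) * √(α + n - 1) * √(n : ℝ)) / 42 := by
  rw [L1, if_neg (by omega), if_neg (by omega), if_pos rfl]

theorem L1_pred (α : ℝ) (n : ℕ) : L1 α (n + 1) n = L1 α n (n + 1) := by
  rw [L1_succ, L1, if_pos rfl]
  push_cast
  ring_nf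

theorem L1_self (α : ℝ) (n : ℕ) : L1 α n n = ((n : ℝ) - 1) * (n - 5) / 21 := by
  rw [L1, if_neg (by omega), if_pos rfl]

theorem L1_of_lt (α : ℝ) {i j : ℕ} (h : i + 1 < j ∨ j + 1 < i) : L1 α i j = 0 := by
  rw [L1, if_neg (by omega), if_neg (by omega), if_neg (by omega)]

theorem isSymmBand_L1 (α : ℝ) : IsSymmBand 1 (L1 α) := by
  refine ⟨Matrix.IsSymm.ext fun i j => ?_, fun i j h => L1_of_lt α h⟩
  by_cases h : i + 1 < j ∨ j + 1 < i
  · rw [L1_of_lt α h, L1_of_lt α h.symm]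
  · obtain rfl | rfl | rfl : j = i ∨ j = i + 1 ∨ i = j + 1 := by omega
    · rfl
    · exact L1_pred α i
    · exact (L1_pred α j).symm

theorem L2_succ_succ (α : ℝ) (n : ℕ) :
    L2 α n (n + 2) = √(α + n + 2) * √(α + n - 1) * √((n : ℝ) + 1) * √(n : ℝ) := by
  rw [L2, if_neg (by omega), if_neg (by omega), if_neg (by omega), if_neg (by omega), if_pos rfl]

theorem L2_pred_pred (α : ℝ) (n : ℕ) : L2 α (n + 2) n = L2 α n (n + 2) := by
  rw [L2_succ_succ, L2, if_pos rfl]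
  push_cast
  ring_nf

theorem L2_succ (α : ℝ) (n : ℕ) :
    L2 α n (n + 1) = -4 * √(α + n + 1) * √(α + n) * √(α + n - 1) * √(n : ℝ) := by
  rw [L2, if_neg (by omega), if_neg (by omega), if_neg (by omega), if_pos rfl]

theorem L2_pred (α : ℝ) (n : ℕ) : L2 α (n + 1) n = L2 α n (n + 1) := by
  rw [L2_succ, L2, if_neg (by omega), if_pos rfl]
  push_cast
  ring_nf

theorem L2_self (α : ℝ) (n : ℕ) :
    L2 α n n = 4 * α ^ 2 + 10 * α * n + 6 * (n : ℝ) ^ 2 - 5 * α - 6 * n := by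
  rw [L2, if_neg (by omega), if_neg (by omega), if_pos rfl]

theorem L2_of_lt (α : ℝ) {i j : ℕ} (h : i + 2 < j ∨ j + 2 < i) : L2 α i j = 0 := by
  rw [L2, if_neg (by omega), if_neg (by omega), if_neg (by omega), if_neg (by omega),
    if_neg (by omega)]

theorem isSymmBand_L2 (α : ℝ) : IsSymmBand 2 (L2 α) := by
  refine ⟨Matrix.IsSymm.ext fun i j => ?_, fun i j h => L2_of_lt α h⟩
  by_cases h : i + 2 < j ∨ j + 2 < i
  · rw [L2_of_lt α h, L2_of_lt α h.symm]
  · obtain rfl | rfl | rfl | rfl | rfl :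
      j = i ∨ j = i + 1 ∨ i = j + 1 ∨ j = i + 2 ∨ i = j + 2 := by omega
    · rfl
    · exact L2_pred α i
    · exact (L2_pred α j).symm
    · exact L2_pred_pred α i
    · exact (L2_pred_pred α j).symm

/-! ### The eigenvalue and recurrence relations -/

theorem eval_xLaguerre_succ (α : ℝ) (m : ℕ) (x : ℝ) :
    (xLaguerre α (m + 1)).eval x =
      normFactor α m * (darboux α (laguerre (α - 1) m)).eval x := by
  rw [xLaguerre_succ, eval_mul, eval_C]

theorem eval_derivative_xLaguerre_succ (α : ℝ) (m : ℕ) (x : ℝ) :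
    (derivative (xLaguerre α (m + 1))).eval x =
      normFactor α m * ((x + α) * (derivative (derivative (laguerre (α - 1) m))).eval x
        - (x + α) * (derivative (laguerre (α - 1) m)).eval x - (laguerre (α - 1) m).eval x) := by
  rw [xLaguerre_succ, darboux]
  simp only [derivative_mul, derivative_C, derivative_add, derivative_sub, derivative_X,
    derivative_one, eval_mul, eval_add, eval_sub, eval_C, eval_X, eval_zero, eval_one]
  ring

theorem eval_derivative_derivative_xLaguerre_succ (α : ℝ) (m : ℕ) (x : ℝ) :
    (derivative (derivative (xLaguerre α (m + 1)))).eval x =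
      normFactor α m *
        ((x + α) * (derivative (derivative (derivative (laguerre (α - 1) m)))).eval x
        + (1 - (x + α)) * (derivative (derivative (laguerre (α - 1) m))).eval x
        - 2 * (derivative (laguerre (α - 1) m)).eval x) := by
  rw [xLaguerre_succ, darboux]
  simp only [derivative_mul, derivative_C, derivative_add, derivative_sub, derivative_X,
    derivative_one, eval_mul, eval_add, eval_sub, eval_C, eval_X, eval_zero, eval_one,
    derivative_zero]
  ring

/-- With `y = L_m^{(α-1)}`, both sides are combinations of `y` and its derivatives up to order
three; Laguerre's equation and its derivative eliminate those of order two and three. -/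
theorem D0_qfun (α : ℝ) (hα : 0 < α) (n : ℕ) :
    D0 α hα (qfun α n) = bandAct 0 L0 (qfun α) n := by
  refine ev_injective fun x => ?_
  rw [ev_bandAct, Finset.sum_range_succ, Finset.sum_eq_zero, zero_add]
  · rcases n with _ | m
    · rw [qfun_zero, map_zero, xLaguerre_zero]; simp
    · have hu := add_ne α hα x x.2
      simp only [D0, LinearMap.add_apply, Module.End.mul_apply, mulOp_apply, pow_two,
        qfun_eq_polyFn, ddx_polyFn, map_add, map_mul, ev_polyFn, ev_smoothOf, L0, if_pos]
      rw [eval_derivative_derivative_xLaguerre_succ, eval_derivative_xLaguerre_succ,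
        eval_xLaguerre_succ, darboux_eval]
      have e1 := laguerre_ode_eval α m x
      have e2 := derivative_laguerre_ode_eval α m x
      push_cast
      field_simp
      linear_combination normFactor α m * (((x : ℝ) + α) ^ 2 * e2
        - (x + α) * (1 + (x + α)) * e1)
  · intro j hj
    have := Finset.mem_range.1 hj
    rw [L0, if_neg (by omega), zero_mul]

theorem bandAct_L1_sum (α : ℝ) (n : ℕ) (x : Set.Ioi (0 : ℝ)) :
    ev x (bandAct 1 (L1 α) (qfun α) (n + 1)) =
      L1 α n (n + 1) * (xLaguerre α n).eval (x : ℝ)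
      + L1 α (n + 1) (n + 1) * (xLaguerre α (n + 1)).eval (x : ℝ)
      + L1 α (n + 1) (n + 2) * (xLaguerre α (n + 2)).eval (x : ℝ) := by
  rw [ev_bandAct, Finset.sum_range_succ, Finset.sum_range_succ, Finset.sum_range_succ,
    Finset.sum_eq_zero, zero_add, L1_pred]
  intro j hj
  have := Finset.mem_range.1 hj
  rw [L1_of_lt α (by omega), zero_mul]

theorem L1_mul_xLaguerre_raise (α : ℝ) (hα : 0 < α) (m : ℕ) (x : ℝ) :
    L1 α (m + 1) (m + 2) * (xLaguerre α (m + 2)).eval x =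
      -normFactor α m * (α + m + 1) / 42 *
        ((m + 1) * (darboux α (laguerre (α - 1) (m + 1))).eval x) := by
  rw [L1_succ, eval_xLaguerre_succ]
  have h := normFactor_raise α hα m
  push_cast
  rw [show α + ((m : ℝ) + 1) + 1 = α + m + 2 by ring, show α + ((m : ℝ) + 1) = α + m + 1 by ring,
    show α + (m : ℝ) + 1 - 1 = α + m by ring]
  linear_combination -(darboux α (laguerre (α - 1) (m + 1))).eval x / 42 * h

/-- At `m = 0` the left side vanishes because `q_0 = 0`, the right side because
`L_0^{(α-1)} = 1`. -/
theorem L1_mul_xLaguerre_lower (α : ℝ) (hα : 0 < α) (m : ℕ) (x : ℝ) :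
    L1 α m (m + 1) * (xLaguerre α m).eval x =
      -normFactor α m * (α + m + 1) / 42 *
        (((x + α) * (α + m - 1) + x) * (derivative (laguerre (α - 1) m)).eval x
          - m * (laguerre (α - 1) m).eval x) := by
  rcases m with _ | m
  · rw [xLaguerre_zero, laguerre_zero]; simp
  · rw [L1_succ, eval_xLaguerre_succ]
    have h := normFactor_lower α hα m
    have h' := darboux_laguerre_lower α m x
    push_cast
    rw [show α + ((m : ℝ) + 1) + 1 = α + m + 2 by ring, show α + ((m : ℝ) + 1) = α + m + 1 by ring,
      show α + (m : ℝ) + 1 - 1 = α + m by ring]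
    linear_combination -(darboux α (laguerre (α - 1) m)).eval x / 42 * h
      - normFactor α (m + 1) * (α + m + 2) / 42 * h'

/-- The terms of `L_1` with indices `m` and `m + 2` are expressed in `y = L_m^{(α-1)}` and `y'`; the
rest is as for `D_0`. -/
theorem D1_qfun (α : ℝ) (hα : 0 < α) (n : ℕ) :
    D1 α hα (qfun α n) = bandAct 1 (L1 α) (qfun α) n := by
  refine ev_injective fun x => ?_
  rcases n with _ | m
  · rw [qfun_zero, map_zero, ev_bandAct]
    simp [xLaguerre_zero, L1]
  · have hu := add_ne α hα x x.2
    rw [bandAct_L1_sum, L1_mul_xLaguerre_raise α hα, L1_mul_xLaguerre_lower α hα,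
      darboux_laguerre_raise, L1_self]
    simp only [D1, LinearMap.add_apply, LinearMap.sub_apply, Module.End.mul_apply, mulOp_apply,
      pow_two, qfun_eq_polyFn, ddx_polyFn, map_add, map_sub, map_mul, ev_polyFn, ev_smoothOf]
    rw [eval_derivative_derivative_xLaguerre_succ, eval_derivative_xLaguerre_succ,
      eval_xLaguerre_succ, darboux_eval]
    have e1 := laguerre_ode_eval α m x
    have e2 := derivative_laguerre_ode_eval α m x
    push_cast
    field_simp
    linear_combination 21 * normFactor α m * (((x : ℝ) + α) ^ 2 * (3 * α + 10 - x) * e2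
      - (x + α) * ((3 * α + 10 - x) + (3 * α + 10 - x) * (x + α) + (x + α)) * e1)

theorem bandAct_L2_sum (α : ℝ) (n : ℕ) (x : Set.Ioi (0 : ℝ)) :
    ev x (bandAct 2 (L2 α) (qfun α) (n + 2)) =
      L2 α n (n + 2) * (xLaguerre α n).eval (x : ℝ)
      + L2 α (n + 1) (n + 2) * (xLaguerre α (n + 1)).eval (x : ℝ)
      + L2 α (n + 2) (n + 2) * (xLaguerre α (n + 2)).eval (x : ℝ)
      + L2 α (n + 2) (n + 3) * (xLaguerre α (n + 3)).eval (x : ℝ)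
      + L2 α (n + 2) (n + 4) * (xLaguerre α (n + 4)).eval (x : ℝ) := by
  rw [ev_bandAct, Finset.sum_range_succ, Finset.sum_range_succ, Finset.sum_range_succ,
    Finset.sum_range_succ, Finset.sum_range_succ,
    Finset.sum_eq_zero, zero_add, L2_pred_pred, L2_pred α (n + 1)]
  intro j hj
  have := Finset.mem_range.1 hj
  rw [L2_of_lt α (by omega), zero_mul]

theorem L2_eq_L1 (α : ℝ) (n : ℕ) : L2 α n (n + 1) = 168 * L1 α n (n + 1) := by
  rw [L1_succ, L2_succ]; ring

theorem L2_mul_xLaguerre_raise (α : ℝ) (hα : 0 < α) (m : ℕ) (x : ℝ) :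
    L2 α (m + 1) (m + 3) * (xLaguerre α (m + 3)).eval x =
      normFactor α m *
        ((m + 1) * (m + 2) * (darboux α (laguerre (α - 1) (m + 2))).eval x) := by
  rw [L2_succ_succ, eval_xLaguerre_succ]
  have h := normFactor_raise_two α hα m
  push_cast
  rw [show α + ((m : ℝ) + 1) + 2 = α + m + 3 by ring,
    show α + ((m : ℝ) + 1) - 1 = α + m by ring, show (m : ℝ) + 1 + 1 = m + 2 by ring]
  linear_combination (darboux α (laguerre (α - 1) (m + 2))).eval x * h

theorem L2_mul_xLaguerre_lower (α : ℝ) (hα : 0 < α) (m : ℕ) (x : ℝ) :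
    L2 α m (m + 2) * (xLaguerre α m).eval x =
      normFactor α (m + 1) * (α + m + 2) *
        (((x + α) * (α + m - 1) + x) * (derivative (laguerre (α - 1) (m + 1))).eval x
          + (x + α - 1) * ((m + 1) * (laguerre (α - 1) (m + 1)).eval x
          - x * (derivative (laguerre (α - 1) (m + 1))).eval x)) := by
  rcases m with _ | m
  · rw [xLaguerre_zero]
    have h1 := laguerre_raise_eval α 0 x
    have h2 := derivative_laguerre_succ_eval α 0 x
    rw [laguerre_zero, derivative_one] at h1 h2
    simp only [Nat.cast_zero, zero_add, one_mul, mul_zero, eval_zero, eval_one, mul_one,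
      zero_sub] at h1 h2 ⊢
    rw [h1, h2]
    ring
  · rw [L2_succ_succ, eval_xLaguerre_succ]
    have h := normFactor_lower_two α hα m
    have h' := darboux_laguerre_lower_two α m x
    push_cast
    rw [show α + ((m : ℝ) + 1) + 2 = α + m + 3 by ring,
      show α + ((m : ℝ) + 1) - 1 = α + m by ring, show (m : ℝ) + 1 + 1 = m + 2 by ring]
    linear_combination (darboux α (laguerre (α - 1) m)).eval x * h
      + normFactor α (m + 2) * (α + m + 3) * h'

/-- All five terms of the recurrence are expressed in `y = L_{m+1}^{(α-1)}` and `y'`; no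
differential equation is needed. -/
theorem D2_qfun (α : ℝ) (hα : 0 < α) (n : ℕ) :
    D2 α (qfun α n) = bandAct 2 (L2 α) (qfun α) n := by
  refine ev_injective fun x => ?_
  have hD : ∀ n, ev x (D2 α (qfun α n)) = (x + α) ^ 2 * (xLaguerre α n).eval (x : ℝ) :=
    fun n => rfl
  rw [hD]
  rcases n with _ | _ | m
  · rw [xLaguerre_zero, ev_bandAct]
    simp [xLaguerre_zero, L2]
  · have h1 := L1_mul_xLaguerre_raise α hα 0 x
    have h2 := L2_mul_xLaguerre_raise α hα 0 x
    rw [darboux_laguerre_raise] at h1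
    rw [darboux_laguerre_raise_two] at h2
    rw [ev_bandAct, Finset.sum_range_succ, Finset.sum_range_succ, Finset.sum_range_succ,
      Finset.sum_range_succ, Finset.sum_range_zero]
    simp only [zero_add] at h1 h2 ⊢
    rw [L2_eq_L1 α 1, mul_assoc, h1, h2, L2_self, xLaguerre_zero, eval_xLaguerre_succ α 0,
      darboux_eval, laguerre_zero]
    simp only [derivative_one, eval_zero, eval_one, Nat.cast_zero, Nat.cast_one]
    ring
  · have h0 := L2_mul_xLaguerre_lower α hα m x
    have h1 := L1_mul_xLaguerre_lower α hα (m + 1) x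
    have h2 := L1_mul_xLaguerre_raise α hα (m + 1) x
    have h3 := L2_mul_xLaguerre_raise α hα (m + 1) x
    rw [darboux_laguerre_raise] at h2
    rw [darboux_laguerre_raise_two] at h3
    rw [bandAct_L2_sum, L2_eq_L1 α (m + 1), L2_eq_L1 α (m + 2), mul_assoc, mul_assoc 168, h0, h1,
      h2, h3, L2_self, eval_xLaguerre_succ α (m + 1), darboux_eval]
    push_cast
    ring

/-! ### Operators acting on a sequence by symmetric band matrices -/

/-- The operator `A` acts on the sequence `q` as the symmetric band matrix `L`. -/
def Intertwines (q : ℕ → SmoothFn) (k : ℕ) (A : Module.End ℝ SmoothFn) (L : Matrix ℕ ℕ ℝ) : Prop :=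
  IsSymmBand k L ∧ ∀ n, A (q n) = bandAct k L q n

theorem bandAct_eq_sum_range {k : ℕ} {L : Matrix ℕ ℕ ℝ} (hL : IsSymmBand k L) (q : ℕ → SmoothFn)
    {n K : ℕ} (hK : n + k + 1 ≤ K) : bandAct k L q n = ∑ j ∈ Finset.range K, L n j • q j := by
  refine Finset.sum_subset (Finset.range_mono hK) fun j _ hj => ?_
  rw [Finset.mem_range, not_lt] at hj
  rw [hL.2 n j (Or.inl (by omega)), zero_smul]

/-- The anticommutator of two band matrices. The range of summation contains all the nonzero terms
when the bandwidths are at most `2`. -/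
def symProd (L M : Matrix ℕ ℕ ℝ) : Matrix ℕ ℕ ℝ := fun n k =>
  ∑ j ∈ Finset.range (n + k + 5), (L n j * M j k + M n j * L j k)

theorem isSymmBand_symProd {k l : ℕ} {L M : Matrix ℕ ℕ ℝ} (hL : IsSymmBand k L)
    (hM : IsSymmBand l M) : IsSymmBand (k + l) (symProd L M) := by
  refine ⟨Matrix.IsSymm.ext fun i j => ?_, fun i j h => Finset.sum_eq_zero fun r _ => ?_⟩
  · rw [symProd, symProd, add_comm j i]
    refine Finset.sum_congr rfl fun r _ => ?_
    rw [hL.1.apply r j, hL.1.apply i r, hM.1.apply i r, hM.1.apply r j]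
    ring
  · have h1 : L i r * M r j = 0 := by
      by_cases h' : i + k < r ∨ r + k < i
      · rw [hL.2 i r h', zero_mul]
      · rw [hM.2 r j (by omega), mul_zero]
    have h2 : M i r * L r j = 0 := by
      by_cases h' : i + l < r ∨ r + l < i
      · rw [hM.2 i r h', zero_mul]
      · rw [hL.2 r j (by omega), mul_zero]
    rw [h1, h2, add_zero]

/-- Since operators act on the sequence and matrices on the index, the order of the factors is
reversed: `A B` acts as the matrix product `M L`. -/
theorem Intertwines.mul_apply {q : ℕ → SmoothFn} {k l : ℕ} {A B : Module.End ℝ SmoothFn}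
    {L M : Matrix ℕ ℕ ℝ} (hA : Intertwines q k A L) (hB : Intertwines q l B M) (hl : l ≤ 2)
    (n : ℕ) : (A * B) (q n) = ∑ i ∈ Finset.range (n + (k + l) + 1),
      (∑ j ∈ Finset.range (n + i + 5), M n j * L j i) • q i := by
  rw [Module.End.mul_apply, hB.2, bandAct, map_sum]
  have h : ∀ j ∈ Finset.range (n + l + 1), A (M n j • q j) =
      ∑ i ∈ Finset.range (n + (k + l) + 1), (M n j * L j i) • q i := by
    intro j hj
    have := Finset.mem_range.1 hj
    rw [map_smul, hA.2, bandAct_eq_sum_range hA.1 q (K := n + (k + l) + 1) (by omega),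
      Finset.smul_sum]
    exact Finset.sum_congr rfl fun i _ => smul_smul _ _ _
  rw [Finset.sum_congr rfl h, Finset.sum_comm]
  refine Finset.sum_congr rfl fun i _ => ?_
  rw [← Finset.sum_smul]
  congr 1
  refine Finset.sum_subset (Finset.range_mono (by omega)) fun j _ hj => ?_
  rw [Finset.mem_range, not_lt] at hj
  rw [hB.1.2 n j (Or.inl (by omega)), zero_mul]

theorem Intertwines.anticomm {q : ℕ → SmoothFn} {k l : ℕ} {A B : Module.End ℝ SmoothFn}
    {L M : Matrix ℕ ℕ ℝ} (hA : Intertwines q k A L) (hB : Intertwines q l B M) (hk : k ≤ 2)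
    (hl : l ≤ 2) : Intertwines q (k + l) (A * B + B * A) (symProd L M) := by
  refine ⟨isSymmBand_symProd hA.1 hB.1, fun n => ?_⟩
  rw [LinearMap.add_apply, hA.mul_apply hB hl, hB.mul_apply hA hk, add_comm l k, bandAct,
    ← Finset.sum_add_distrib]
  refine Finset.sum_congr rfl fun i _ => ?_
  rw [← add_smul, ← Finset.sum_add_distrib]
  congr 1
  exact Finset.sum_congr rfl fun j _ => add_comm _ _

theorem Intertwines.mono {q : ℕ → SmoothFn} {k l : ℕ} {A : Module.End ℝ SmoothFn}
    {L : Matrix ℕ ℕ ℝ} (hA : Intertwines q k A L) (h : k ≤ l) : Intertwines q l A L := by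
  refine ⟨⟨hA.1.1, fun i j hij => hA.1.2 i j (by omega)⟩, fun n => ?_⟩
  rw [hA.2, bandAct_eq_sum_range hA.1 q (K := n + l + 1) (by omega), bandAct]

theorem Intertwines.add {q : ℕ → SmoothFn} {k : ℕ} {A B : Module.End ℝ SmoothFn}
    {L M : Matrix ℕ ℕ ℝ} (hA : Intertwines q k A L) (hB : Intertwines q k B M) :
    Intertwines q k (A + B) (L + M) := by
  refine ⟨⟨hA.1.1.add hB.1.1, fun i j h => ?_⟩, fun n => ?_⟩
  · rw [Matrix.add_apply, hA.1.2 i j h, hB.1.2 i j h, add_zero]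
  · rw [LinearMap.add_apply, hA.2, hB.2, bandAct, bandAct, bandAct, ← Finset.sum_add_distrib]
    exact Finset.sum_congr rfl fun j _ => by rw [Matrix.add_apply, add_smul]

theorem Intertwines.smul {q : ℕ → SmoothFn} {k : ℕ} {A : Module.End ℝ SmoothFn}
    {L : Matrix ℕ ℕ ℝ} (r : ℝ) (hA : Intertwines q k A L) :
    Intertwines q k (r • A) (r • L) := by
  refine ⟨⟨hA.1.1.smul r, fun i j h => ?_⟩, fun n => ?_⟩
  · rw [Matrix.smul_apply, hA.1.2 i j h, smul_zero]
  · rw [LinearMap.smul_apply, hA.2, bandAct, bandAct, Finset.smul_sum]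
    exact Finset.sum_congr rfl fun j _ => by rw [Matrix.smul_apply, smul_assoc]

theorem intertwines_one (q : ℕ → SmoothFn) : Intertwines q 0 1 1 := by
  refine ⟨⟨Matrix.isSymm_one, fun i j h => Matrix.one_apply_ne (by omega)⟩, fun n => ?_⟩
  rw [bandAct, Finset.sum_eq_single n]
  · rw [Matrix.one_apply_eq, one_smul]; rfl
  · intro j _ h
    rw [Matrix.one_apply_ne h.symm, zero_smul]
  · intro h
    simp at h

theorem intertwines_D0 (α : ℝ) (hα : 0 < α) : Intertwines (qfun α) 0 (D0 α hα) L0 :=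
  ⟨isSymmBand_L0, D0_qfun α hα⟩

theorem intertwines_D1 (α : ℝ) (hα : 0 < α) : Intertwines (qfun α) 1 (D1 α hα) (L1 α) :=
  ⟨isSymmBand_L1 α, D1_qfun α hα⟩

theorem intertwines_D2 (α : ℝ) (hα : 0 < α) : Intertwines (qfun α) 2 (D2 α) (L2 α) :=
  ⟨isSymmBand_L2 α, D2_qfun α hα⟩

theorem Intertwines.sq {q : ℕ → SmoothFn} {k : ℕ} {A : Module.End ℝ SmoothFn}
    {L : Matrix ℕ ℕ ℝ} (hA : Intertwines q k A L) (hk : k ≤ 1) :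
    Intertwines q 2 (A ^ 2) ((1 / 2 : ℝ) • symProd L L) := by
  rw [sq_eq_half_anticomm]
  exact ((hA.anticomm hA (by omega) (by omega)).smul _).mono (by omega)

theorem Y_mem_fourierSym (α : ℝ) (hα : 0 < α) (i : Fin 8) :
    Y α hα i ∈ FourierSym (qfun α) 2 2 := by
  refine ⟨?_, ?_⟩
  · obtain ⟨a, g, c, h⟩ := Y_eq_symOp α hα i
    exact ⟨_, h⟩
  · have h0 := intertwines_D0 α hα
    have h1 := intertwines_D1 α hα
    have h2 := intertwines_D2 α hα
    suffices ∃ L, Intertwines (qfun α) 2 (Y α hα i) L from this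
    fin_cases i
    · exact ⟨_, (intertwines_one _).mono (by norm_num)⟩
    · exact ⟨_, h0.mono (by norm_num)⟩
    · exact ⟨_, h1.mono (by norm_num)⟩
    · exact ⟨_, h2⟩
    · exact ⟨_, h0.sq (by norm_num)⟩
    · exact ⟨_, h1.sq (by norm_num)⟩
    · exact ⟨_, (h0.anticomm h1 (by norm_num) (by norm_num)).mono (by norm_num)⟩
    · exact ⟨_, h2.anticomm h0 (by norm_num) (by norm_num)⟩

/-- The matrix by which `T` acts on the exceptional Laguerre polynomials. -/
def matT (α Ω N : ℝ) : Matrix ℕ ℕ ℝ :=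
  (1764 : ℝ) • ((1 / 2 : ℝ) • symProd (L1 α) (L1 α))
  + (168 * (Ω - 3 * α - 10)) • symProd L0 (L1 α)
  + (16 * (Ω - 3 * α - 10) ^ 2) • ((1 / 2 : ℝ) • symProd L0 L0)
  + (4 * (N + α)) • symProd L0 (L2 α)
  + (42 * (2 * N * Ω + 2 * N * α + 4 * α ^ 2 - 5 * Ω + 15 * α + 40)) • L1 α
  + (4 * (-8 * N * Ω * α - 2 * Ω ^ 2 * α - 8 * N * α ^ 2 - 14 * α ^ 3 - 20 * N * Ω - 5 * Ω ^ 2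
      - 20 * N * α + 30 * Ω * α - 85 * α ^ 2 + 90 * Ω - 270 * α - 400)) • L0
  + ((N + α) * (N - α - 5)) • L2 α

theorem intertwines_T (α : ℝ) (hα : 0 < α) (Ω N : ℝ) :
    Intertwines (qfun α) 2 (T α hα Ω N) (matT α Ω N) := by
  have h0 := intertwines_D0 α hα
  have h1 := intertwines_D1 α hα
  have h2 := intertwines_D2 α hα
  exact (((((((h1.sq (by norm_num)).smul _).add
    (((h0.anticomm h1 (by norm_num) (by norm_num)).mono (by norm_num)).smul _)).add
    ((h0.sq (by norm_num)).smul _)).add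
    ((h0.anticomm h2 (by norm_num) (by norm_num)).smul _)).add
    ((h1.mono (by norm_num)).smul _)).add ((h0.mono (by norm_num)).smul _)).add (h2.smul _)

theorem symProd_L0 (M : Matrix ℕ ℕ ℝ) (n k : ℕ) :
    symProd L0 M n k = ((3 - n) / 4 + (3 - k) / 4) * M n k := by
  rw [symProd, Finset.sum_add_distrib, Finset.sum_eq_single n, Finset.sum_eq_single k]
  · rw [L0, L0, if_pos rfl, if_pos rfl]
    ring
  · intro j _ h
    rw [L0, if_neg h.symm, mul_zero]
  · intro h
    exact absurd (Finset.mem_range.2 (by omega)) h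
  · intro j _ h
    rw [L0, if_neg h, zero_mul]
  · intro h
    exact absurd (Finset.mem_range.2 (by omega)) h

theorem symProd_L1_succ (α : ℝ) (n : ℕ) :
    symProd (L1 α) (L1 α) n (n + 1) =
      2 * ((L1 α n n + L1 α (n + 1) (n + 1)) * L1 α n (n + 1)) := by
  have hsub : ({n, n + 1} : Finset ℕ) ⊆ Finset.range (n + (n + 1) + 5) := by
    intro j hj
    simp only [Finset.mem_insert, Finset.mem_singleton] at hj
    exact Finset.mem_range.2 (by omega)
  rw [symProd, ← Finset.sum_subset hsub, Finset.sum_pair (by omega)]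
  · ring
  · intro j _ hj
    simp only [Finset.mem_insert, Finset.mem_singleton, not_or] at hj
    by_cases h : n + 1 < j ∨ j + 1 < n
    · rw [L1_of_lt α h]; ring
    · rw [L1_of_lt α (i := j) (j := n + 1) (by omega)]; ring

theorem symProd_L1_succ_succ (α : ℝ) (n : ℕ) :
    symProd (L1 α) (L1 α) n (n + 2) = 2 * (L1 α n (n + 1) * L1 α (n + 1) (n + 2)) := by
  rw [symProd, Finset.sum_eq_single (n + 1)]
  · ring
  · intro j _ hj
    by_cases h : n + 1 < j ∨ j + 1 < n
    · rw [L1_of_lt α h]; ring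
    · rw [L1_of_lt α (i := j) (j := n + 2) (by omega)]; ring
  · intro h
    exact absurd (Finset.mem_range.2 (by omega)) h

theorem L1_mul_L1 (α : ℝ) (hα : 0 < α) (n : ℕ) :
    1764 * (L1 α n (n + 1) * L1 α (n + 1) (n + 2)) =
      (α + n + 1) * (α + n) * L2 α n (n + 2) := by
  rw [L1_succ, L1_succ, L2_succ_succ]
  have h1 := Real.mul_self_sqrt (show 0 ≤ α + n + 1 by positivity)
  have h2 := Real.mul_self_sqrt (show 0 ≤ α + n by positivity)
  push_cast
  rw [show α + ((n : ℝ) + 1) + 1 = α + n + 2 by ring, show α + ((n : ℝ) + 1) = α + n + 1 by ring,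
    show α + (n : ℝ) + 1 - 1 = α + n by ring]
  linear_combination √(α + n + 2) * √(α + n - 1) * √((n : ℝ) + 1) * √(n : ℝ) *
    (√(α + n) * √(α + n) * h1 + (α + n + 1) * h2)

/-- The coefficients of `T` are chosen so that this entry and the two entries given by
`matT_succ_succ` at `n = N - 1, N` vanish. -/
theorem matT_succ_self (α Ω : ℝ) (N : ℕ) : matT α Ω N N (N + 1) = 0 := by
  simp only [matT, Matrix.add_apply, Matrix.smul_apply, symProd_L0, symProd_L1_succ, L1_self,
    L2_eq_L1, smul_eq_mul]
  rw [L0, if_neg (by omega)]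
  push_cast
  ring

theorem matT_succ_succ (α : ℝ) (hα : 0 < α) (Ω N : ℝ) (n : ℕ) :
    matT α Ω N n (n + 2) = (n - N) * (n - N + 1) * L2 α n (n + 2) := by
  simp only [matT, Matrix.add_apply, Matrix.smul_apply, symProd_L0, symProd_L1_succ_succ,
    smul_eq_mul]
  rw [L0, if_neg (by omega), L1_of_lt α (i := n) (j := n + 2) (by omega)]
  push_cast
  linear_combination L1_mul_L1 α hα n

/-- The matrix of `T` splits at `N`: it has no entries coupling indices `≤ N` and `> N`. -/
theorem matT_eq_zero (α : ℝ) (hα : 0 < α) (Ω : ℝ) {N i j : ℕ} (hi : i ≤ N) (hj : N < j) :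
    matT α Ω N i j = 0 := by
  by_cases h : i + 2 < j
  · exact (intertwines_T α hα Ω N).1.2 i j (Or.inl h)
  · obtain ⟨rfl, rfl⟩ | ⟨rfl, rfl⟩ | ⟨rfl, rfl⟩ :
      (i = N ∧ j = i + 1) ∨ (i = N ∧ j = i + 2) ∨ (N = i + 1 ∧ j = i + 2) := by omega
    · exact matT_succ_self α Ω i
    · rw [matT_succ_succ α hα, sub_self]; ring
    · rw [matT_succ_succ α hα]; push_cast; ring

theorem T_mem_fourierSym (α : ℝ) (hα : 0 < α) (Ω N : ℝ) :
    T α hα Ω N ∈ FourierSym (qfun α) 2 2 :=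
  ⟨⟨_, T_eq_symOp α hα Ω N⟩, _, intertwines_T α hα Ω N⟩

/-! ### Orthogonality of the classical Laguerre polynomials -/

theorem integrableOn_poly_mul_gamma {s : ℝ} (hs : 0 < s) (p : ℝ[X]) :
    IntegrableOn (fun x => p.eval x * (Real.exp (-x) * x ^ (s - 1))) (Set.Ioi 0) := by
  induction p using Polynomial.induction_on' with
  | add p q hp hq =>
    refine (Integrable.add hp hq).congr (.of_forall fun x => ?_)
    simp only [Pi.add_apply, eval_add, add_mul]
  | monomial k c =>
    have h : IntegrableOn (fun x : ℝ => c * (Real.exp (-x) * x ^ (s + (k : ℝ) - 1)))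
        (Set.Ioi 0) := (Real.GammaIntegral_convergent (s := s + k) (by positivity)).const_mul c
    refine IntegrableOn.congr_fun h (fun x hx => ?_) measurableSet_Ioi
    have hx : 0 < x := hx
    simp only [eval_monomial]
    rw [show s + (k : ℝ) - 1 = (s - 1) + k by ring, Real.rpow_add_natCast hx.ne']
    ring

/-- The moment functional `p ↦ ∫₀^∞ p(x) e^{-x} x^{s-1} dx` on polynomials. -/
def gammaFunctional (s : ℝ) (p : ℝ[X]) : ℝ :=
  ∫ x in Set.Ioi 0, p.eval x * (Real.exp (-x) * x ^ (s - 1))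

theorem gammaFunctional_add {s : ℝ} (hs : 0 < s) (p q : ℝ[X]) :
    gammaFunctional s (p + q) = gammaFunctional s p + gammaFunctional s q := by
  simp only [gammaFunctional, eval_add, add_mul]
  exact integral_add (integrableOn_poly_mul_gamma hs p) (integrableOn_poly_mul_gamma hs q)

theorem gammaFunctional_C_mul (s c : ℝ) (p : ℝ[X]) :
    gammaFunctional s (C c * p) = c * gammaFunctional s p := by
  simp only [gammaFunctional, eval_mul, eval_C, mul_assoc]
  exact integral_const_mul _ _

theorem gammaFunctional_neg (s : ℝ) (p : ℝ[X]) :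
    gammaFunctional s (-p) = -gammaFunctional s p := by
  rw [← neg_one_mul, ← C_1, ← C_neg, gammaFunctional_C_mul, neg_one_mul]

theorem gammaFunctional_zero (s : ℝ) : gammaFunctional s 0 = 0 := by
  simp [gammaFunctional]

theorem gammaFunctional_monomial {s : ℝ} (hs : 0 < s) (k : ℕ) (c : ℝ) :
    gammaFunctional s (monomial k c) = c * Real.Gamma (s + k) := by
  rw [Real.Gamma_eq_integral (by positivity), gammaFunctional, ← integral_const_mul]
  refine setIntegral_congr_fun measurableSet_Ioi fun x hx => ?_
  have hx : 0 < x := hx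
  simp only [eval_monomial]
  rw [show s + (k : ℝ) - 1 = (s - 1) + k by ring, Real.rpow_add_natCast hx.ne']
  ring

theorem gammaFunctional_X_mul (s : ℝ) (p : ℝ[X]) :
    gammaFunctional s (X * p) = gammaFunctional (s + 1) p := by
  refine setIntegral_congr_fun measurableSet_Ioi fun x hx => ?_
  have hx : 0 < x := hx
  simp only [eval_mul, eval_X]
  rw [show s + 1 - 1 = (s - 1) + 1 by ring, Real.rpow_add_one hx.ne']
  ring

/-- Integration by parts for the moment functional; it amounts to `Γ(s + 1) = s Γ(s)`. -/
theorem gammaFunctional_by_parts {s : ℝ} (hs : 0 < s) (p : ℝ[X]) :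
    gammaFunctional s (X * derivative p + C s * p) = gammaFunctional s (X * p) := by
  induction p using Polynomial.induction_on' with
  | add p q hp hq =>
    rw [mul_add X, gammaFunctional_add hs (X * p), ← hp, ← hq, ← gammaFunctional_add hs]
    congr 1
    rw [derivative_add]
    ring
  | monomial k c =>
    rw [gammaFunctional_X_mul, gammaFunctional_monomial (by positivity), gammaFunctional_add hs,
      gammaFunctional_C_mul, gammaFunctional_monomial hs, gammaFunctional_X_mul,
      derivative_monomial, gammaFunctional_monomial (by positivity)]
    have h : Real.Gamma (s + 1 + k) = (s + k) * Real.Gamma (s + k) := by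
      rw [← Real.Gamma_add_one (by positivity)]; ring_nf
    rcases k with _ | k
    · simp only [Nat.cast_zero, add_zero, mul_zero, zero_mul, zero_add] at h ⊢
      rw [h]; ring
    · rw [h, show s + 1 + ((k + 1 - 1 : ℕ) : ℝ) = s + ((k + 1 : ℕ) : ℝ) by push_cast; ring]
      ring

/-- Lowering the degree and raising the parameter, the step in the proof of orthogonality. -/
theorem gammaFunctional_laguerre_succ_mul {s : ℝ} (hs : 0 < s) (m : ℕ) (r : ℝ[X]) :
    (m + 1) * gammaFunctional s (laguerre (s - 1) (m + 1) * r) =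
      -gammaFunctional (s + 1) (laguerre s m * derivative r) := by
  have h := gammaFunctional_by_parts hs (laguerre s m * r)
  have e := laguerre_succ_rodrigues (s - 1) m
  rw [sub_add_cancel] at e
  have : X * derivative (laguerre s m * r) + C s * (laguerre s m * r) =
      C ((m : ℝ) + 1) * (laguerre (s - 1) (m + 1) * r) + (X * (laguerre s m * derivative r)
        + X * (laguerre s m * r)) := by
    rw [← mul_assoc (C ((m : ℝ) + 1)), e, derivative_mul]
    ring
  rw [this, gammaFunctional_add hs, gammaFunctional_add hs, gammaFunctional_C_mul,
    gammaFunctional_X_mul s (laguerre s m * derivative r)] at h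
  linarith

theorem gammaFunctional_laguerre_mul_laguerre {s : ℝ} (hs : 0 < s) (m k : ℕ) :
    gammaFunctional s (laguerre (s - 1) m * laguerre (s - 1) k) =
      if m = k then Real.Gamma (s + m) / m.factorial else 0 := by
  have hz : ∀ {s : ℝ}, 0 < s → ∀ m : ℕ, gammaFunctional s (laguerre (s - 1) (m + 1) * 1) = 0 := by
    intro s hs m
    have h := gammaFunctional_laguerre_succ_mul hs m 1
    rw [derivative_one, mul_zero, gammaFunctional_zero, neg_zero] at h
    exact (mul_eq_zero.1 h).resolve_left (by positivity)
  induction m generalizing s k with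
  | zero =>
    rcases k with _ | k
    · have h := gammaFunctional_monomial hs 0 1
      simp only [laguerre_zero, mul_one, monomial_zero_left, C_1] at h ⊢
      rw [h]
      simp
    · rw [if_neg (by omega), mul_comm, laguerre_zero, hz hs]
  | succ m ih =>
    rcases k with _ | k
    · rw [if_neg (by omega), laguerre_zero, hz hs]
    · have h := gammaFunctional_laguerre_succ_mul hs m (laguerre (s - 1) (k + 1))
      rw [derivative_laguerre_succ, sub_add_cancel, mul_neg, gammaFunctional_neg,
        neg_neg] at h
      have h' := ih (s := s + 1) (by positivity) k
      rw [add_sub_cancel_right] at h'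
      rw [h'] at h
      have hm : (m : ℝ) + 1 ≠ 0 := by positivity
      by_cases hk : m = k
      · subst hk
        rw [if_pos rfl] at h ⊢
        rw [show s + 1 + (m : ℝ) = s + ((m + 1 : ℕ) : ℝ) by push_cast; ring] at h
        rw [Nat.factorial_succ]
        push_cast at h ⊢
        have : (m.factorial : ℝ) ≠ 0 := by positivity
        field_simp at h ⊢
        linarith
      · rw [if_neg hk] at h
        rw [if_neg (by omega)]
        simpa [hm] using h

/-! ### Orthonormality of the exceptional Laguerre polynomials -/

theorem measurable_weight (α : ℝ) : Measurable (weight α) := by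
  unfold weight
  fun_prop

theorem integral_weightMeasure (α : ℝ) (hα : 0 < α) (f : ℝ → ℝ) :
    ∫ x, f x ∂(weightMeasure α) = ∫ x in Set.Ioi 0, weight α x * f x := by
  rw [weightMeasure, integral_withDensity_eq_integral_toReal_smul
    (measurable_weight α).ennreal_ofReal (by simp)]
  refine setIntegral_congr_fun measurableSet_Ioi fun x hx => ?_
  simp only [smul_eq_mul]
  rw [ENNReal.toReal_ofReal (weight_pos α hα x hx).le]

theorem integrable_weightMeasure (α : ℝ) (hα : 0 < α) (f : ℝ → ℝ) :
    Integrable f (weightMeasure α) ↔ IntegrableOn (fun x => weight α x * f x) (Set.Ioi 0) := by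
  rw [weightMeasure, integrable_withDensity_iff_integrable_smul'
    (measurable_weight α).ennreal_ofReal (by simp)]
  refine integrableOn_congr_fun (fun x hx => ?_) measurableSet_Ioi
  simp only [smul_eq_mul]
  rw [ENNReal.toReal_ofReal (weight_pos α hα x hx).le]

theorem weight_mul_sq (α : ℝ) (hα : 0 < α) {x : ℝ} (hx : 0 < x) :
    weight α x * (x + α) ^ 2 = Real.exp (-x) * x ^ (α + 1 - 1) := by
  have := add_ne α hα x hx
  rw [weight, add_sub_cancel_right]
  field_simp

theorem integrableOn_weight_mul_poly (α : ℝ) (hα : 0 < α) (p : ℝ[X]) :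
    IntegrableOn (fun x => weight α x * p.eval x) (Set.Ioi 0) := by
  have h := (integrableOn_poly_mul_gamma (s := α + 1) (by positivity) p).norm.const_mul (1 / α ^ 2)
  refine Integrable.mono' h
    ((measurable_weight α).mul p.continuous.measurable).aestronglyMeasurable ?_
  refine (ae_restrict_iff' measurableSet_Ioi).2 (.of_forall fun x hx => ?_)
  have hx : 0 < x := hx
  have hw := weight_pos α hα x hx
  rw [← weight_mul_sq α hα hx, norm_mul, norm_mul, norm_mul, Real.norm_of_nonneg hw.le,
    Real.norm_of_nonneg (sq_nonneg _)]
  have h1 : 1 ≤ 1 / α ^ 2 * (x + α) ^ 2 := by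
    rw [one_div_mul_eq_div, one_le_div (by positivity)]
    gcongr
    linarith
  calc weight α x * ‖p.eval x‖ = weight α x * ‖p.eval x‖ * 1 := by ring
    _ ≤ weight α x * ‖p.eval x‖ * (1 / α ^ 2 * (x + α) ^ 2) := by gcongr
    _ = _ := by ring

theorem integrable_poly (α : ℝ) (hα : 0 < α) (p : ℝ[X]) :
    Integrable (fun x => p.eval x) (weightMeasure α) :=
  (integrable_weightMeasure α hα _).2 (integrableOn_weight_mul_poly α hα p)

theorem tendsto_poly_mul_gamma (a : ℝ) (p : ℝ[X]) :
    Filter.Tendsto (fun x => p.eval x * (Real.exp (-x) * x ^ a)) Filter.atTop (nhds 0) := by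
  induction p using Polynomial.induction_on' with
  | add p q hp hq => simpa only [eval_add, add_mul, add_zero] using hp.add hq
  | monomial k c =>
    have h := (tendsto_rpow_mul_exp_neg_mul_atTop_nhds_zero (a + k) 1 one_pos).const_mul c
    rw [mul_zero] at h
    refine h.congr' ?_
    filter_upwards [Filter.eventually_gt_atTop 0] with x hx
    rw [eval_monomial, Real.rpow_add_natCast hx.ne']
    ring_nf

/-- The Darboux transform is, up to the factor `α + m + 1`, isometric from `x^{α-1} e^{-x} dx` to
`w dx`: with `u = x + α` and `y = L_m^{(α-1)}`, the function `x^α e^{-x} (Ay) z / u` has derivative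
`w (Ay) (Az) - (α + m + 1) x^{α-1} e^{-x} y z`, by Laguerre's differential equation. -/
theorem integral_darboux_mul_darboux (α : ℝ) (hα : 0 < α) (m : ℕ) (z : ℝ[X]) :
    ∫ x in Set.Ioi 0, weight α x *
        (darboux α (laguerre (α - 1) m) * darboux α z).eval x =
      (α + m + 1) * gammaFunctional α (laguerre (α - 1) m * z) := by
  set y := laguerre (α - 1) m with hy
  have i1 := integrableOn_weight_mul_poly α hα (darboux α y * darboux α z)
  have i2 := (integrableOn_poly_mul_gamma hα (y * z)).const_mul (α + m + 1)
  have key : ∫ x in Set.Ioi 0, (weight α x * (darboux α y * darboux α z).eval x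
      - (α + m + 1) * ((y * z).eval x * (Real.exp (-x) * x ^ (α - 1)))) =
      0 - (darboux α y * z).eval 0 * (Real.exp (-0) * 0 ^ α) / (0 + α) := by
    refine integral_Ioi_of_hasDerivAt_of_tendsto
      (f := fun x => (darboux α y * z).eval x * (Real.exp (-x) * x ^ α) / (x + α)) ?_ ?_
      (i1.sub i2) ?_
    · refine ContinuousAt.continuousWithinAt ?_
      refine ContinuousAt.div ?_ (by fun_prop) (by simpa using hα.ne')
      refine (Polynomial.continuousAt _).mul (ContinuousAt.mul (by fun_prop) ?_)
      exact Real.continuousAt_rpow_const _ _ (Or.inr hα.le)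
    · intro x hx
      have hx : 0 < x := hx
      have hu := add_ne α hα x hx
      have h1 : HasDerivAt (fun y : ℝ => Real.exp (-y)) (-Real.exp (-x)) x := by
        simpa using (hasDerivAt_neg x).exp
      have h2 : HasDerivAt (fun y : ℝ => y ^ α) (α * x ^ (α - 1)) x := by
        simpa using Real.hasDerivAt_rpow_const (p := α) (Or.inl hx.ne')
      have h3 := (hasDerivAt_id' x).add_const α
      refine ((((darboux α y * z).hasDerivAt x).mul (h1.mul h2)).div h3 hu).congr_deriv ?_
      have e := laguerre_ode_eval α m x
      rw [← hy] at e
      have hr : x ^ α = x ^ (α - 1) * x := by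
        rw [Real.rpow_sub_one hx.ne']; field_simp
      simp only [weight, darboux, derivative_mul, derivative_add, derivative_sub, derivative_X,
        derivative_C, derivative_one, eval_mul, eval_add, eval_sub, eval_X, eval_C, eval_one,
        eval_zero, Pi.mul_apply, hr]
      field_simp
      linear_combination ((x + α) ^ 2 * z.eval x) * e
    · have h := (tendsto_poly_mul_gamma α (darboux α y * z)).div_atTop
        (Filter.tendsto_atTop_add_const_right _ α Filter.tendsto_id)
      exact h
  rw [Real.zero_rpow hα.ne', mul_zero, mul_zero, zero_div, sub_zero, integral_sub i1 i2,
    integral_const_mul] at key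
  rw [gammaFunctional]
  linarith

theorem normFactor_sq (α : ℝ) (hα : 0 < α) (m : ℕ) :
    normFactor α m * normFactor α m * ((α + m + 1) * (Real.Gamma (α + m) / m.factorial)) = 1 := by
  have hΓ : 0 < Real.Gamma (α + m) := Real.Gamma_pos_of_pos (by positivity)
  have hΓ' : Real.Gamma (m + 1 + α) = (α + m) * Real.Gamma (α + m) := by
    rw [← Real.Gamma_add_one (by positivity)]; ring_nf
  rw [normFactor, hΓ', Real.mul_self_sqrt (by positivity)]
  have : (m.factorial : ℝ) ≠ 0 := by positivity
  have : α + m + 1 ≠ 0 := by positivity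
  have : α + m ≠ 0 := by positivity
  field_simp

theorem integral_xLaguerre_mul (α : ℝ) (hα : 0 < α) (m n : ℕ) (hm : 1 ≤ m) (hn : 1 ≤ n) :
    ∫ x, (xLaguerre α m).eval x * (xLaguerre α n).eval x ∂(weightMeasure α) =
      if m = n then 1 else 0 := by
  obtain ⟨m, rfl⟩ := Nat.exists_eq_add_of_le' hm
  obtain ⟨n, rfl⟩ := Nat.exists_eq_add_of_le' hn
  have e : ∀ x, weight α x * ((xLaguerre α (m + 1)).eval x * (xLaguerre α (n + 1)).eval x) =
      normFactor α m * normFactor α n * (weight α x *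
        (darboux α (laguerre (α - 1) m) * darboux α (laguerre (α - 1) n)).eval x) := by
    intro x
    rw [eval_xLaguerre_succ, eval_xLaguerre_succ, eval_mul]
    ring
  rw [integral_weightMeasure α hα]
  simp only [e]
  rw [integral_const_mul, integral_darboux_mul_darboux α hα,
    gammaFunctional_laguerre_mul_laguerre hα]
  by_cases h : m = n
  · subst h
    rw [if_pos rfl, if_pos rfl, normFactor_sq α hα]
  · rw [if_neg h, if_neg (by omega), mul_zero, mul_zero]

/-! ### Completeness of the exceptional Laguerre polynomials -/

/-- Finite measures with some exponential moments are determined by their moments: their complex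
moment generating functions are analytic on a strip around the imaginary axis, and have the same
Taylor series at `0`. -/
theorem measure_ext_of_moments {μ ν : Measure ℝ} [IsFiniteMeasure μ] [IsFiniteMeasure ν] {ε : ℝ}
    (hε : 0 < ε)
    (hμ : ∀ t ∈ Set.Icc (-ε) ε, Integrable (fun x => Real.exp (t * x)) μ)
    (hν : ∀ t ∈ Set.Icc (-ε) ε, Integrable (fun x => Real.exp (t * x)) ν)
    (h : ∀ k : ℕ, ∫ x, x ^ k ∂μ = ∫ x, x ^ k ∂ν) : μ = ν := by
  have hsub : ∀ {μ : Measure ℝ}, (∀ t ∈ Set.Icc (-ε) ε, Integrable (fun x => Real.exp (t * x)) μ) →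
      Set.Ioo (-ε) ε ⊆ interior (ProbabilityTheory.integrableExpSet id μ) := fun h =>
    interior_maximal (fun t ht => h t (Set.Ioo_subset_Icc_self ht)) isOpen_Ioo
  set U : Set ℂ := {z | z.re ∈ Set.Ioo (-ε) ε} with hU
  have an : ∀ {μ : Measure ℝ}, (∀ t ∈ Set.Icc (-ε) ε, Integrable (fun x => Real.exp (t * x)) μ) →
      AnalyticOnNhd ℂ (ProbabilityTheory.complexMGF id μ) U := fun h z hz =>
    ProbabilityTheory.analyticAt_complexMGF (hsub h hz)
  have h0 : (0 : ℂ) ∈ U := by simp [hU, hε]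
  have hpre : IsPreconnected U :=
    ((convex_Ioo (-ε) ε).linear_preimage Complex.reLm).isPreconnected
  have hd : ∀ n, iteratedDeriv n (ProbabilityTheory.complexMGF id μ) 0 =
      iteratedDeriv n (ProbabilityTheory.complexMGF id ν) 0 := by
    intro n
    rw [ProbabilityTheory.iteratedDeriv_complexMGF (hsub hμ h0),
      ProbabilityTheory.iteratedDeriv_complexMGF (hsub hν h0)]
    simp only [id, zero_mul, Complex.exp_zero, mul_one]
    have := congrArg (fun r : ℝ => (r : ℂ)) (h n)
    simpa only [← integral_complex_ofReal, Complex.ofReal_pow] using this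
  have hs1 := (an hμ 0 h0).hasFPowerSeriesAt
  have hs2 := (an hν 0 h0).hasFPowerSeriesAt
  simp only [hd] at hs1
  have hs := hs1.sub hs2
  rw [sub_self] at hs
  have heq : ProbabilityTheory.complexMGF id μ =ᶠ[nhds 0] ProbabilityTheory.complexMGF id ν := by
    filter_upwards [hs.eventually_eq_zero] with z hz
    exact sub_eq_zero.1 hz
  have hE := (an hμ).eqOn_of_preconnected_of_eventuallyEq (an hν) hpre h0 heq
  refine Measure.ext_of_charFun ?_
  funext t
  rw [← ProbabilityTheory.complexMGF_id_mul_I, ← ProbabilityTheory.complexMGF_id_mul_I]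
  exact hE (by simp [hU, hε])

/-- A function with some exponential moments, all of whose power moments vanish, is zero. -/
theorem ae_eq_zero_of_moments {μ : Measure ℝ} {g : ℝ → ℝ} {ε : ℝ} (hε : 0 < ε)
    (hg : ∀ t ∈ Set.Icc (-ε) ε, Integrable (fun x => g x * Real.exp (t * x)) μ)
    (hm : ∀ k : ℕ, ∫ x, g x * x ^ k ∂μ = 0) : g =ᵐ[μ] 0 := by
  have hg0 : Integrable g μ := by simpa using hg 0 ⟨by linarith, by linarith⟩
  -- both parts of `g` are treated at once, as the positive parts of `g` and `-g`
  have meas : ∀ {f : ℝ → ℝ}, Integrable f μ → AEMeasurable (fun x => ENNReal.ofReal (f x)) μ :=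
    fun hf => hf.aemeasurable.ennreal_ofReal
  have key : ∀ {f : ℝ → ℝ}, Integrable f μ →
      (∀ t ∈ Set.Icc (-ε) ε, Integrable (fun x => f x * Real.exp (t * x)) μ) →
      ∀ t ∈ Set.Icc (-ε) ε, Integrable (fun x => Real.exp (t * x))
        (μ.withDensity fun x => ENNReal.ofReal (f x)) := by
    intro f hf0 hf t ht
    rw [integrable_withDensity_iff_integrable_smul₀' (meas hf0) (by simp)]
    refine (hf t ht).pos_part.congr (.of_forall fun x => ?_)
    simp only [smul_eq_mul, ENNReal.toReal_ofReal', max_mul_of_nonneg _ _ (Real.exp_pos _).le,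
      zero_mul]
  have hn0 : Integrable (fun x => -g x) μ := hg0.neg
  have hn : ∀ t ∈ Set.Icc (-ε) ε, Integrable (fun x => -g x * Real.exp (t * x)) μ := fun t ht =>
    (hg t ht).neg.congr (.of_forall fun x => (neg_mul _ _).symm)
  have fin : ∀ {f : ℝ → ℝ}, Integrable f μ →
      IsFiniteMeasure (μ.withDensity fun x => ENNReal.ofReal (f x)) := fun hf =>
    isFiniteMeasure_withDensity_ofReal hf.2
  have hp_fin := fin hg0
  have hn_fin := fin hn0
  have pow_int : ∀ {f : ℝ → ℝ}, Integrable f μ →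
      (∀ t ∈ Set.Icc (-ε) ε, Integrable (fun x => f x * Real.exp (t * x)) μ) → ∀ k : ℕ,
      Integrable (fun x => max (f x) 0 * x ^ k) μ := by
    intro f hf0 hf k
    have h1 : (0 : ℝ) ∈ interior (ProbabilityTheory.integrableExpSet id
        (μ.withDensity fun x => ENNReal.ofReal (f x))) :=
      interior_maximal (fun t ht => key hf0 hf t (Set.Ioo_subset_Icc_self ht)) isOpen_Ioo
        (show (0 : ℝ) ∈ Set.Ioo (-ε) ε by simp [hε])
    have h2 := ProbabilityTheory.integrable_pow_of_mem_interior_integrableExpSet h1 k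
    rw [integrable_withDensity_iff_integrable_smul₀' (meas hf0) (by simp)] at h2
    simpa only [smul_eq_mul, ENNReal.toReal_ofReal', id] using h2
  have hmeq := measure_ext_of_moments hε (key hg0 hg) (key hn0 hn) fun k => by
    rw [integral_withDensity_eq_integral_toReal_smul₀ (meas hg0) (by simp),
      integral_withDensity_eq_integral_toReal_smul₀ (meas hn0) (by simp), ← sub_eq_zero]
    simp only [smul_eq_mul, ENNReal.toReal_ofReal']
    rw [← integral_sub (pow_int hg0 hg k) (pow_int hn0 hn k)]
    refine Eq.trans (integral_congr_ae (.of_forall fun x => ?_)) (hm k)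
    simp only [← sub_mul]
    congr 1
    rcases le_total (g x) 0 with h | h
    · rw [max_eq_right h, max_eq_left (by linarith)]; ring
    · rw [max_eq_left h, max_eq_right (by linarith)]; ring
  have hfin : ∫⁻ x, ENNReal.ofReal (g x) ∂μ ≠ ⊤ := by
    have := hp_fin.measure_univ_lt_top
    rw [withDensity_apply _ MeasurableSet.univ, setLIntegral_univ] at this
    exact this.ne
  filter_upwards [(withDensity_eq_iff (meas hg0) (meas hn0) hfin).1 hmeq] with x hx
  have hx' := congrArg ENNReal.toReal hx
  rw [ENNReal.toReal_ofReal', ENNReal.toReal_ofReal'] at hx'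
  rcases le_total (g x) 0 with h | h
  · rw [max_eq_right h, max_eq_left (by linarith)] at hx'
    simpa using hx'.symm
  · rw [max_eq_left h, max_eq_right (by linarith)] at hx'
    exact hx'

theorem natDegree_laguerre_le (a : ℝ) (m : ℕ) : (laguerre a m).natDegree ≤ m :=
  natDegree_le_iff_coeff_eq_zero.2 fun _ h => laguerre_coeff_of_lt a h

theorem coeff_xLaguerre_succ_ne_zero (α : ℝ) (hα : 0 < α) (m : ℕ) :
    (xLaguerre α (m + 1)).coeff (m + 1) ≠ 0 := by
  have hd := natDegree_laguerre_le (α - 1) m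
  have h1 : (laguerre (α - 1) m).coeff (m + 1) = 0 := laguerre_coeff_of_lt _ (Nat.lt_succ_self m)
  have h2 : (laguerre (α - 1) m).coeff (m + 1 + 1) = 0 := laguerre_coeff_of_lt _ (by omega)
  have h3 := laguerre_coeff_add (α - 1) 0 m
  rw [zero_add] at h3
  rw [xLaguerre_succ, coeff_C_mul, darboux]
  have e : (X + C α) * derivative (laguerre (α - 1) m)
      - (X + C α + 1) * laguerre (α - 1) m = X * derivative (laguerre (α - 1) m)
      + C α * derivative (laguerre (α - 1) m) - (X * laguerre (α - 1) m
      + C (α + 1) * laguerre (α - 1) m) := by rw [C_add, C_1]; ring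
  rw [e, coeff_sub, coeff_add, coeff_add, coeff_X_mul, coeff_X_mul, coeff_C_mul, coeff_C_mul,
    coeff_derivative, coeff_derivative, h1, h2, h3]
  simpa using ⟨(normFactor_pos α hα m).ne', m.factorial_ne_zero⟩

theorem natDegree_xLaguerre (α : ℝ) (hα : 0 < α) (n : ℕ) (hn : 1 ≤ n) :
    (xLaguerre α n).natDegree = n := by
  obtain ⟨m, rfl⟩ := Nat.exists_eq_add_of_le' hn
  refine natDegree_eq_of_le_of_coeff_ne_zero ?_ (coeff_xLaguerre_succ_ne_zero α hα m)
  have hd := natDegree_laguerre_le (α - 1) m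
  have hd' : (derivative (laguerre (α - 1) m)).natDegree ≤ m :=
    (natDegree_derivative_le _).trans (by omega)
  rw [xLaguerre_succ, darboux]
  refine (natDegree_C_mul_le _ _).trans ((natDegree_sub_le _ _).trans (max_le ?_ ?_))
  · refine natDegree_mul_le.trans ?_
    rw [natDegree_X_add_C]; omega
  · refine natDegree_mul_le.trans ?_
    rw [add_assoc, ← C_1, ← C_add, natDegree_X_add_C]; omega

/-- The exceptional Laguerre polynomials satisfy the linear condition `p'(-α) = p(-α)`. -/
theorem xLaguerre_condition (α : ℝ) (m : ℕ) :
    (derivative (xLaguerre α (m + 1))).eval (-α) = (xLaguerre α (m + 1)).eval (-α) := by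
  rw [eval_derivative_xLaguerre_succ, eval_xLaguerre_succ, darboux_eval]
  ring

theorem memLp_poly (α : ℝ) (hα : 0 < α) (p : ℝ[X]) :
    MemLp (fun x => p.eval x) 2 (weightMeasure α) := by
  refine (memLp_two_iff_integrable_sq p.continuous.aestronglyMeasurable).2 ?_
  exact (integrable_poly α hα (p ^ 2)).congr (.of_forall fun x => eval_pow _)

/-- The exceptional Laguerre polynomials span the polynomials with `p'(-α) = p(-α)`, so that a
function orthogonal to all of them is orthogonal to every such polynomial. -/
theorem integral_mul_eq_zero_of_condition (α : ℝ) (hα : 0 < α) {f : ℝ → ℝ}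
    (hf : MemLp f 2 (weightMeasure α))
    (h : ∀ n : ℕ, 1 ≤ n → ∫ x, f x * (xLaguerre α n).eval x ∂(weightMeasure α) = 0)
    (d : ℕ) : ∀ p : ℝ[X], p.natDegree ≤ d → (derivative p).eval (-α) = p.eval (-α) →
      ∫ x, f x * p.eval x ∂(weightMeasure α) = 0 := by
  induction d with
  | zero =>
    intro p hp hc
    rw [eq_C_of_natDegree_le_zero hp] at hc ⊢
    rw [derivative_C, eval_zero, eval_C] at hc
    simp [← hc]
  | succ d ih =>
    intro p hp hc
    set q := xLaguerre α (d + 1) with hq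
    set t := p.coeff (d + 1) / q.coeff (d + 1) with ht
    have hq0 : q.coeff (d + 1) ≠ 0 := coeff_xLaguerre_succ_ne_zero α hα d
    have hqd := natDegree_xLaguerre α hα (d + 1) (by omega)
    have h1 := ih (p - C t * q) ?_ ?_
    · have i1 : Integrable (fun x => f x * p.eval x) (weightMeasure α) :=
        hf.integrable_mul (memLp_poly α hα p)
      have i2 : Integrable (fun x => f x * q.eval x) (weightMeasure α) :=
        hf.integrable_mul (memLp_poly α hα q)
      have e : ∀ x, f x * (p - C t * q).eval x = f x * p.eval x - t * (f x * q.eval x) := by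
        intro x
        rw [eval_sub, eval_mul, eval_C]
        ring
      simp only [e] at h1
      rw [integral_sub i1 (i2.const_mul t), integral_const_mul, h (d + 1) (by omega), mul_zero,
        sub_zero] at h1
      exact h1
    · refine natDegree_le_iff_coeff_eq_zero.2 fun k hk => ?_
      rw [coeff_sub, coeff_C_mul]
      rcases Nat.lt_or_ge (d + 1) k with hk' | hk'
      · rw [coeff_eq_zero_of_natDegree_lt (by omega),
          coeff_eq_zero_of_natDegree_lt (by rw [hq, hqd]; exact hk')]
        ring
      · obtain rfl : k = d + 1 := by omega
        rw [ht, div_mul_cancel₀ _ hq0, sub_self]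
    · have hc' := xLaguerre_condition α d
      rw [derivative_sub, derivative_C_mul, eval_sub, eval_sub, eval_mul, eval_mul, hc, hq, hc',
        eval_C]

/-- Since `w (x + α)^2 = e^{-x} x^α`, exponentials `e^{tx}` with `2 t < 1` are admissible. -/
theorem memLp_sq_mul_exp (α : ℝ) (hα : 0 < α) {t : ℝ} (ht : t ≤ 1 / 4) :
    MemLp (fun x => (x + α) ^ 2 * Real.exp (t * x)) 2 (weightMeasure α) := by
  have hcont : Continuous fun x : ℝ => (x + α) ^ 2 * Real.exp (t * x) := by fun_prop
  rw [memLp_two_iff_integrable_sq hcont.aestronglyMeasurable, integrable_weightMeasure α hα]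
  have hi : ∀ s : ℝ, 0 ≤ s → IntegrableOn (fun x : ℝ => x ^ s * Real.exp (-(1 / 2) * x ^ (1 : ℝ)))
      (Set.Ioi 0) := fun s hs =>
    integrableOn_rpow_mul_exp_neg_mul_rpow (by linarith) one_pos (by norm_num)
  have hb := ((hi (α + 2) (by linarith)).add ((hi (α + 1) (by linarith)).const_mul (2 * α))).add
    ((hi α hα.le).const_mul (α ^ 2))
  refine Integrable.mono' hb
    ((measurable_weight α).mul (hcont.pow 2).measurable).aestronglyMeasurable ?_
  refine (ae_restrict_iff' measurableSet_Ioi).2 (.of_forall fun x hx => ?_)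
  have hx : 0 < x := hx
  have hw := weight_pos α hα x hx
  rw [Real.norm_of_nonneg (by positivity)]
  simp only [Pi.add_apply]
  rw [Real.rpow_one, show α + 2 = α + (2 : ℕ) by norm_num, Real.rpow_add_natCast hx.ne',
    Real.rpow_add_one hx.ne']
  have e := weight_mul_sq α hα hx
  rw [add_sub_cancel_right] at e
  have he : Real.exp (-x) * Real.exp (t * x) ^ 2 ≤ Real.exp (-(1 / 2) * x) := by
    rw [← Real.exp_nat_mul, ← Real.exp_add]
    refine Real.exp_le_exp.2 ?_
    push_cast
    nlinarith
  calc weight α x * ((x + α) ^ 2 * Real.exp (t * x)) ^ 2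
      = (weight α x * (x + α) ^ 2) * (x + α) ^ 2 * Real.exp (t * x) ^ 2 := by ring
    _ = (x ^ α * (x + α) ^ 2) * (Real.exp (-x) * Real.exp (t * x) ^ 2) := by rw [e]; ring
    _ ≤ (x ^ α * (x + α) ^ 2) * Real.exp (-(1 / 2) * x) := by gcongr
    _ = _ := by ring

/-- The polynomials `(x + α)^2 x^k` satisfy the condition `p'(-α) = p(-α)`, so that all moments of
`(x + α)^2 f` vanish. -/
theorem ae_eq_zero_of_orthogonal (α : ℝ) (hα : 0 < α) (f : ℝ → ℝ)
    (hf : MemLp f 2 (weightMeasure α))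
    (h : ∀ n : ℕ, 1 ≤ n → ∫ x, f x * (xLaguerre α n).eval x ∂(weightMeasure α) = 0) :
    f =ᵐ[weightMeasure α] 0 := by
  have h0 : (fun x => f x * (x + α) ^ 2) =ᵐ[weightMeasure α] 0 := by
    refine ae_eq_zero_of_moments (ε := 1 / 4) (by norm_num) (fun t ht => ?_) fun k => ?_
    · exact (hf.integrable_mul (memLp_sq_mul_exp α hα ht.2)).congr
        (.of_forall fun x => (mul_assoc _ _ _).symm)
    · have := integral_mul_eq_zero_of_condition α hα hf h _ ((X + C α) ^ 2 * X ^ k) le_rfl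
        (by simp [derivative_mul, derivative_pow])
      simpa only [eval_mul, eval_pow, eval_add, eval_X, eval_C, mul_assoc] using this
  have hpos : ∀ᵐ x ∂(weightMeasure α), x ∈ Set.Ioi (0 : ℝ) :=
    (withDensity_absolutelyContinuous _ _).ae_le (ae_restrict_mem measurableSet_Ioi)
  filter_upwards [h0, hpos] with x hx hx'
  exact (mul_eq_zero.1 hx).resolve_right (pow_ne_zero 2 (add_ne α hα x hx'))

/-! ### Green's formula for `T` on `(0, Ω)` -/

theorem hasDerivAt_iteratedDeriv {f : ℝ → ℝ} {s : Set ℝ} (hs : IsOpen s) {n : ℕ}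
    (hf : ContDiffOn ℝ n f s) {j : ℕ} (hj : j < n) {x : ℝ} (hx : x ∈ s) :
    HasDerivAt (iteratedDeriv j f) (iteratedDeriv (j + 1) f x) x := by
  have h := hf.differentiableOn_iteratedDerivWithin (m := j) (by exact_mod_cast hj) hs.uniqueDiffOn
  have h' : DifferentiableAt ℝ (iteratedDeriv j f) x :=
    ((h x hx).differentiableAt (hs.mem_nhds hx)).congr_of_eventuallyEq (by
      filter_upwards [hs.mem_nhds hx] with y hy
      exact (iteratedDerivWithin_of_isOpen hs hy).symm)
  rw [iteratedDeriv_succ]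
  exact h'.hasDerivAt

/-- The coefficients of `T`. -/
def coeffT (α : ℝ) (hα : 0 < α) (Ω N : ℝ) : ℕ → SmoothFn :=
  symCoeff (logDerivWeight α hα) (f2 Ω) (gT α hα Ω N) (cT α hα Ω N)

/-- The bilinear concomitant of `T` for the weight `w`: its derivative is `w (p Tf - f Tp)`. -/
def concomitant (α : ℝ) (hα : 0 < α) (Ω N : ℝ) (f p : ℝ → ℝ) (x : ℝ) : ℝ :=
  weight α x * (ext (f2 Ω) x * (iteratedDeriv 0 p x * iteratedDeriv 3 f x
      - iteratedDeriv 1 p x * iteratedDeriv 2 f x - iteratedDeriv 0 f x * iteratedDeriv 3 p x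
      + iteratedDeriv 1 f x * iteratedDeriv 2 p x)
    + ext (ddx (f2 Ω) + logDerivWeight α hα * f2 Ω) x *
      (iteratedDeriv 0 p x * iteratedDeriv 2 f x - iteratedDeriv 0 f x * iteratedDeriv 2 p x)
    + ext (gT α hα Ω N) x *
      (iteratedDeriv 0 p x * iteratedDeriv 1 f x - iteratedDeriv 0 f x * iteratedDeriv 1 p x))

theorem ext_mul (f g : SmoothFn) {x : ℝ} (hx : 0 < x) : ext (f * g) x = ext f x * ext g x := by
  rw [← ev_eq_ext ⟨x, hx⟩, ← ev_eq_ext ⟨x, hx⟩, ← ev_eq_ext ⟨x, hx⟩, map_mul]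

theorem ext_add (f g : SmoothFn) {x : ℝ} (hx : 0 < x) : ext (f + g) x = ext f x + ext g x := by
  rw [← ev_eq_ext ⟨x, hx⟩, ← ev_eq_ext ⟨x, hx⟩, ← ev_eq_ext ⟨x, hx⟩, map_add]

theorem ext_ofNat (n : ℕ) [n.AtLeastTwo] {x : ℝ} (hx : 0 < x) :
    ext (ofNat(n) : SmoothFn) x = ofNat(n) := by
  rw [← ev_eq_ext ⟨x, hx⟩, map_ofNat]

theorem ext_logDerivWeight (α : ℝ) (hα : 0 < α) {x : ℝ} (hx : 0 < x) :
    ext (logDerivWeight α hα) x = α * x⁻¹ - 2 * (x + α)⁻¹ - 1 := by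
  rw [← ev_eq_ext ⟨x, hx⟩]
  simp only [logDerivWeight, map_mul, map_sub, AlgHom.commutes, map_ofNat, map_one, invX, invU,
    ev_smoothOf, Algebra.algebraMap_self, RingHom.id_apply]

theorem hasDerivAt_concomitant (α : ℝ) (hα : 0 < α) (Ω N : ℝ) {f p : ℝ → ℝ}
    (hf : ContDiffOn ℝ 4 f (Set.Ioo 0 Ω)) (hp : ContDiffOn ℝ 4 p (Set.Ioo 0 Ω)) {x : ℝ}
    (hx : x ∈ Set.Ioo 0 Ω) :
    HasDerivAt (concomitant α hα Ω N f p)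
      (weight α x * (p x * diffAct 4 (coeffT α hα Ω N) f x
        - f x * diffAct 4 (coeffT α hα Ω N) p x)) x := by
  have hx0 : 0 < x := hx.1
  have F : ∀ j < 4, HasDerivAt (iteratedDeriv j f) (iteratedDeriv (j + 1) f x) x := fun j hj =>
    hasDerivAt_iteratedDeriv isOpen_Ioo (n := 4) hf hj hx
  have P : ∀ j < 4, HasDerivAt (iteratedDeriv j p) (iteratedDeriv (j + 1) p x) x := fun j hj =>
    hasDerivAt_iteratedDeriv isOpen_Ioo (n := 4) hp hj hx
  have F0 := F 0 (by norm_num)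
  have F1 := F 1 (by norm_num)
  have F2 := F 2 (by norm_num)
  have F3 := F 3 (by norm_num)
  have P0 := P 0 (by norm_num)
  have P1 := P 1 (by norm_num)
  have P2 := P 2 (by norm_num)
  have P3 := P 3 (by norm_num)
  have hA := hasDerivAt_ext (f2 Ω) hx0
  have hA1 := hasDerivAt_ext (ddx (f2 Ω) + logDerivWeight α hα * f2 Ω) hx0
  have hG := hasDerivAt_ext (gT α hα Ω N) hx0
  have hW := hasDerivAt_weight α hα hx0
  rw [← ext_logDerivWeight α hα hx0] at hW
  refine (hW.mul (((hA.mul ((((P0.mul F3).sub (P1.mul F2)).sub (F0.mul P3)).add (F1.mul P2))).add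
    (hA1.mul ((P0.mul F2).sub (F0.mul P2)))).add
    (hG.mul ((P0.mul F1).sub (F0.mul P1))))).congr_deriv ?_
  simp only [diffAct, Finset.sum_range_succ, Finset.sum_range_zero, coeffT, symCoeff, map_add,
    ddx_mul, ext_add _ _ hx0, ext_mul _ _ hx0, ext_ofNat _ hx0, Pi.add_apply, Pi.mul_apply,
    Pi.sub_apply, iteratedDeriv_zero]
  ring

/-- A coefficient with the factor `Ω - x` and without a pole at `0` gives vanishing boundary terms
at both ends. -/
theorem tendsto_weight_mul (α : ℝ) (hα : 0 < α) {Ω : ℝ} (hΩ : 0 < Ω) {g h : ℝ → ℝ}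
    (hh : ContinuousOn h (Set.Ioi (-α)))
    (hg : ∀ x, 0 < x → g x = (Ω - x) * h x) :
    Filter.Tendsto (fun x => weight α x * g x) (nhdsWithin 0 (Set.Ioi 0)) (nhds 0) ∧
      Filter.Tendsto (fun x => weight α x * g x) (nhdsWithin Ω (Set.Iio Ω)) (nhds 0) := by
  have hw : ∀ x, -α < x → ContinuousAt (weight α) x := by
    intro x hx
    refine ContinuousAt.div (ContinuousAt.mul (by fun_prop) ?_) (by fun_prop)
      (pow_ne_zero 2 (by linarith))
    exact Real.continuousAt_rpow_const _ _ (Or.inr hα.le)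
  have hc : ∀ x, -α < x → ContinuousAt (fun x => weight α x * ((Ω - x) * h x)) x := fun x hx =>
    (hw x hx).mul (ContinuousAt.mul (by fun_prop) (hh.continuousAt (Ioi_mem_nhds hx)))
  constructor
  · have h1 := (hc 0 (by linarith)).tendsto.mono_left (nhdsWithin_le_nhds (s := Set.Ioi 0))
    have h2 : weight α 0 = 0 := by simp [weight, Real.zero_rpow hα.ne']
    rw [h2, zero_mul] at h1
    refine h1.congr' ?_
    filter_upwards [self_mem_nhdsWithin] with x hx
    rw [hg x hx]
  · have h1 := (hc Ω (by linarith)).tendsto.mono_left (nhdsWithin_le_nhds (s := Set.Iio Ω))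
    rw [sub_self, zero_mul, mul_zero] at h1
    refine h1.congr' ?_
    filter_upwards [nhdsWithin_le_nhds (Ioi_mem_nhds hΩ)] with x hx
    rw [hg x hx]

theorem tendsto_weight_mul_f2 (α : ℝ) (hα : 0 < α) {Ω : ℝ} (hΩ : 0 < Ω) :
    Filter.Tendsto (fun x => weight α x * ext (f2 Ω) x) (nhdsWithin 0 (Set.Ioi 0)) (nhds 0) ∧
      Filter.Tendsto (fun x => weight α x * ext (f2 Ω) x) (nhdsWithin Ω (Set.Iio Ω)) (nhds 0) := by
  refine tendsto_weight_mul α hα hΩ (h := fun x => (Ω - x) * x ^ 2) (by fun_prop) fun x hx => ?_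
  rw [f2, ext_smoothOf _ _ hx]
  ring

theorem tendsto_weight_mul_ddx_f2 (α : ℝ) (hα : 0 < α) {Ω : ℝ} (hΩ : 0 < Ω) :
    Filter.Tendsto (fun x => weight α x * ext (ddx (f2 Ω) + logDerivWeight α hα * f2 Ω) x)
        (nhdsWithin 0 (Set.Ioi 0)) (nhds 0) ∧
      Filter.Tendsto (fun x => weight α x * ext (ddx (f2 Ω) + logDerivWeight α hα * f2 Ω) x)
        (nhdsWithin Ω (Set.Iio Ω)) (nhds 0) := by
  refine tendsto_weight_mul α hα hΩ (h := fun x => 2 * x * (Ω - x) - 2 * x ^ 2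
    + (α - 2 * x / (x + α) - x) * (x * (Ω - x))) ?_ fun x hx => ?_
  · have : ∀ x ∈ Set.Ioi (-α), x + α ≠ 0 := fun x hx => by
      have : -α < x := hx
      linarith
    fun_prop (disch := assumption)
  · rw [← ev_eq_ext ⟨x, hx⟩]
    have hu := add_ne α hα x hx
    simp only [f2_eq, logDerivWeight, ddx_mul, ddx_algebraMap, ddx_coordX, LinearMap.map_sub]
    simp only [map_mul, map_sub, map_add, map_zero, map_one, map_ofNat, AlgHom.commutes,
      Algebra.algebraMap_self, RingHom.id_apply, coordX, invX, invU, ev_smoothOf]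
    field_simp
    ring

/-- The coefficient `g` of `T` has no pole at `0` and vanishes at `Ω`. -/
theorem tendsto_weight_mul_gT (α : ℝ) (hα : 0 < α) {Ω : ℝ} (hΩ : 0 < Ω) (N : ℝ) :
    Filter.Tendsto (fun x => weight α x * ext (gT α hα Ω N) x)
        (nhdsWithin 0 (Set.Ioi 0)) (nhds 0) ∧
      Filter.Tendsto (fun x => weight α x * ext (gT α hα Ω N) x)
        (nhdsWithin Ω (Set.Iio Ω)) (nhds 0) := by
  refine tendsto_weight_mul α hα hΩ (h := fun x =>
    (-Ω * (x + α) ^ 4 / 2 + x * (x + α) ^ 3 * (x - 3 * α) / 2 - 2 * N * x * (x + α) ^ 3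
        + 2 * Ω * x * (α - x) - 2 * x * (x ^ 2 + 4 * α * x + α ^ 2)) / (x + α) ^ 2
    + (Ω - x) * ((α - 2 * x / (x + α) - x) ^ 2 / 2 + 2 * (-α + 2 * x ^ 2 / (x + α) ^ 2))
    + 2 * (α - 2 * x / (x + α) - x) * (Ω - 2 * x)) ?_ fun x hx => ?_
  · have h1 : ∀ x ∈ Set.Ioi (-α), x + α ≠ 0 := fun x hx => by
      have : -α < x := hx
      linarith
    have h2 : ∀ x ∈ Set.Ioi (-α), (x + α) ^ 2 ≠ 0 := fun x hx => pow_ne_zero 2 (h1 x hx)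
    fun_prop (disch := assumption)
  · rw [← ev_eq_ext ⟨x, hx⟩]
    have hu := add_ne α hα x hx
    simp only [gT, f2_eq, f1, logDerivWeight, ddx_mul, ddx_algebraMap, ddx_coordX,
      LinearMap.map_sub, ddx_ofNat, ddx_one, ddx_invX, ddx_invU]
    simp only [map_mul, map_sub, map_add, map_neg, map_zero, map_one, map_ofNat, AlgHom.commutes,
      Algebra.algebraMap_self, RingHom.id_apply, coordX, invX, invU, ev_smoothOf]
    field_simp
    ring

/-- Functions of class `C^4` on `(0, Ω)` whose derivatives of order at most three are bounded. -/
def BoundedC4 (Ω : ℝ) (f : ℝ → ℝ) : Prop :=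
  ContDiffOn ℝ 4 f (Set.Ioo 0 Ω) ∧
    ∀ j ≤ 3, ∃ B : ℝ, ∀ x ∈ Set.Ioo 0 Ω, |iteratedDeriv j f x| ≤ B

theorem BoundedC4.exists_bound {Ω : ℝ} {f : ℝ → ℝ} (hf : BoundedC4 Ω f) :
    ∃ B : ℝ, 0 ≤ B ∧ ∀ j ≤ 3, ∀ x ∈ Set.Ioo 0 Ω, |iteratedDeriv j f x| ≤ B := by
  choose! B hB using hf.2
  refine ⟨∑ j ∈ Finset.range 4, |B j|, Finset.sum_nonneg fun _ _ => abs_nonneg _,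
    fun j hj x hx => (hB j hj x hx).trans ((le_abs_self _).trans ?_)⟩
  exact Finset.single_le_sum (f := fun j => |B j|) (fun _ _ => abs_nonneg _)
    (Finset.mem_range.2 (by omega))

theorem tendsto_concomitant (α : ℝ) (hα : 0 < α) {Ω : ℝ} (hΩ : 0 < Ω) (N : ℝ) {f p : ℝ → ℝ}
    (hf : BoundedC4 Ω f) (hp : BoundedC4 Ω p) :
    Filter.Tendsto (concomitant α hα Ω N f p) (nhdsWithin 0 (Set.Ioi 0)) (nhds 0) ∧
      Filter.Tendsto (concomitant α hα Ω N f p) (nhdsWithin Ω (Set.Iio Ω)) (nhds 0) := by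
  obtain ⟨B, hB0, hB⟩ := hf.exists_bound
  obtain ⟨C, hC0, hC⟩ := hp.exists_bound
  have key : ∀ l : Filter ℝ, Set.Ioo 0 Ω ∈ l →
      Filter.Tendsto (fun x => weight α x * ext (f2 Ω) x) l (nhds 0) →
      Filter.Tendsto (fun x => weight α x * ext (ddx (f2 Ω) + logDerivWeight α hα * f2 Ω) x) l
        (nhds 0) →
      Filter.Tendsto (fun x => weight α x * ext (gT α hα Ω N) x) l (nhds 0) →
      Filter.Tendsto (concomitant α hα Ω N f p) l (nhds 0) := by
    intro l hl h1 h2 h3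
    have hs := (((h1.abs.add h2.abs).add h3.abs).const_mul (4 * (B * C)))
    rw [abs_zero, add_zero, add_zero, mul_zero] at hs
    refine squeeze_zero_norm' ?_ hs
    filter_upwards [hl] with x hx
    have hprod : ∀ i ≤ 3, ∀ j ≤ 3, |iteratedDeriv i f x * iteratedDeriv j p x| ≤ B * C := by
      intro i hi j hj
      rw [abs_mul]
      exact mul_le_mul (hB i hi x hx) (hC j hj x hx) (abs_nonneg _) hB0
    have h30 := abs_le.1 (hprod 3 (by norm_num) 0 (by norm_num))
    have h21 := abs_le.1 (hprod 2 (by norm_num) 1 (by norm_num))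
    have h12 := abs_le.1 (hprod 1 (by norm_num) 2 (by norm_num))
    have h03 := abs_le.1 (hprod 0 (by norm_num) 3 (by norm_num))
    have h20 := abs_le.1 (hprod 2 (by norm_num) 0 (by norm_num))
    have h02 := abs_le.1 (hprod 0 (by norm_num) 2 (by norm_num))
    have h10 := abs_le.1 (hprod 1 (by norm_num) 0 (by norm_num))
    have h01 := abs_le.1 (hprod 0 (by norm_num) 1 (by norm_num))
    have hBC : 0 ≤ B * C := mul_nonneg hB0 hC0
    have e1 : |iteratedDeriv 0 p x * iteratedDeriv 3 f x
      - iteratedDeriv 1 p x * iteratedDeriv 2 f x - iteratedDeriv 0 f x * iteratedDeriv 3 p x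
      + iteratedDeriv 1 f x * iteratedDeriv 2 p x| ≤ 4 * (B * C) :=
      abs_le.2 ⟨by linarith, by linarith⟩
    have e2 : |iteratedDeriv 0 p x * iteratedDeriv 2 f x
        - iteratedDeriv 0 f x * iteratedDeriv 2 p x| ≤ 4 * (B * C) :=
      abs_le.2 ⟨by linarith, by linarith⟩
    have e3 : |iteratedDeriv 0 p x * iteratedDeriv 1 f x
        - iteratedDeriv 0 f x * iteratedDeriv 1 p x| ≤ 4 * (B * C) :=
      abs_le.2 ⟨by linarith, by linarith⟩
    rw [Real.norm_eq_abs, concomitant, mul_add, mul_add, ← mul_assoc, ← mul_assoc, ← mul_assoc]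
    refine (abs_add_three _ _ _).trans ?_
    rw [abs_mul (_ * _), abs_mul (_ * _), abs_mul (_ * _), mul_add, mul_add]
    refine add_le_add_three ?_ ?_ ?_ <;>
    · rw [mul_comm (4 * (B * C))]
      exact mul_le_mul_of_nonneg_left (by assumption) (abs_nonneg _)
  have a1 := tendsto_weight_mul_f2 α hα hΩ
  have a2 := tendsto_weight_mul_ddx_f2 α hα hΩ
  have a3 := tendsto_weight_mul_gT α hα hΩ N
  exact ⟨key _ (Ioo_mem_nhdsGT hΩ) a1.1 a2.1 a3.1, key _ (Ioo_mem_nhdsLT hΩ) a1.2 a2.2 a3.2⟩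

/-- Green's formula: all boundary terms vanish, at `0` because `w` does, at `Ω` because of the
factor `Ω - x` in the coefficients of `T`. -/
theorem integral_green (α : ℝ) (hα : 0 < α) {Ω : ℝ} (hΩ : 0 < Ω) (N : ℝ) {f p : ℝ → ℝ}
    (hf : BoundedC4 Ω f) (hp : BoundedC4 Ω p)
    (i1 : IntegrableOn (fun x => weight α x * (p x * diffAct 4 (coeffT α hα Ω N) f x))
      (Set.Ioo 0 Ω))
    (i2 : IntegrableOn (fun x => weight α x * (f x * diffAct 4 (coeffT α hα Ω N) p x))
      (Set.Ioo 0 Ω)) :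
    ∫ x in Set.Ioo 0 Ω, weight α x * (p x * diffAct 4 (coeffT α hα Ω N) f x) =
      ∫ x in Set.Ioo 0 Ω, weight α x * (f x * diffAct 4 (coeffT α hα Ω N) p x) := by
  have ht := tendsto_concomitant α hα hΩ N hf hp
  have hi : IntegrableOn (fun x => weight α x * (p x * diffAct 4 (coeffT α hα Ω N) f x
      - f x * diffAct 4 (coeffT α hα Ω N) p x)) (Set.Ioo 0 Ω) :=
    Integrable.congr (Integrable.sub i1 i2) (.of_forall fun x => by
      simp only [Pi.sub_apply, mul_sub])
  have h := intervalIntegral.integral_eq_sub_of_hasDerivAt_of_tendsto hΩ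
    (fun x hx => hasDerivAt_concomitant α hα Ω N hf.1 hp.1 hx)
    ((intervalIntegrable_iff_integrableOn_Ioo_of_le hΩ.le).2 hi) ht.1 ht.2
  rw [intervalIntegral.integral_of_le hΩ.le, integral_Ioc_eq_integral_Ioo, sub_zero] at h
  rw [← sub_eq_zero, ← integral_sub i1 i2]
  exact (integral_congr_ae (.of_forall fun x => (mul_sub _ _ _).symm)).trans h

/-! ### Commutation of `T` and `S` -/

theorem integrable_weightMeasure_restrict (α : ℝ) (hα : 0 < α) (Ω : ℝ) (f : ℝ → ℝ) :
    Integrable f ((weightMeasure α).restrict (Set.Ioo 0 Ω)) ↔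
      IntegrableOn (fun x => weight α x * f x) (Set.Ioo 0 Ω) := by
  rw [weightMeasure, restrict_withDensity measurableSet_Ioo,
    Measure.restrict_restrict measurableSet_Ioo,
    Set.inter_eq_left.2 Set.Ioo_subset_Ioi_self,
    integrable_withDensity_iff_integrable_smul' (measurable_weight α).ennreal_ofReal (by simp)]
  refine integrableOn_congr_fun (fun x hx => ?_) measurableSet_Ioo
  simp only [smul_eq_mul]
  rw [ENNReal.toReal_ofReal (weight_pos α hα x hx.1).le]

theorem iteratedDeriv_eval (p : ℝ[X]) (j : ℕ) :
    iteratedDeriv j (fun x => p.eval x) = fun x => ((derivative^[j]) p).eval x := by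
  induction j with
  | zero => simp
  | succ j ih =>
    rw [iteratedDeriv_succ, ih, Function.iterate_succ_apply']
    funext x
    exact Polynomial.deriv _

theorem boundedC4_poly (Ω : ℝ) (p : ℝ[X]) : BoundedC4 Ω fun x => p.eval x := by
  refine ⟨by simpa using (p.contDiff_aeval (𝕜 := ℝ) 4).contDiffOn, fun j _ => ?_⟩
  rw [iteratedDeriv_eval]
  obtain ⟨B, hB⟩ := (isCompact_Icc (a := (0 : ℝ)) (b := Ω)).exists_bound_of_continuousOn
    ((derivative^[j]) p).continuousOn
  exact ⟨B, fun x hx => hB x (Set.Ioo_subset_Icc_self hx)⟩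

theorem iterate_ddx_polyFn (p : ℝ[X]) (j : ℕ) :
    (ddx ^ j) (polyFn p) = polyFn ((derivative^[j]) p) := by
  induction j with
  | zero => rfl
  | succ j ih =>
    rw [pow_succ', Module.End.mul_apply, ih, ddx_polyFn, Function.iterate_succ_apply']

theorem diffAct_poly (m : ℕ) (c : ℕ → SmoothFn) (p : ℝ[X]) {x : ℝ} (hx : 0 < x) :
    diffAct m c (fun x => p.eval x) x = ext (diffOp m c (polyFn p)) x := by
  rw [← ev_eq_ext ⟨x, hx⟩, diffOp_apply, map_sum, diffAct]
  refine Finset.sum_congr rfl fun j _ => ?_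
  rw [map_mul, iterate_ddx_polyFn, ev_eq_ext, iteratedDeriv_eval]
  rfl

/-- The action of `T` on a linear combination of the first `N + 1` exceptional Laguerre
polynomials. -/
theorem diffAct_coeffT_sum (α : ℝ) (hα : 0 < α) (Ω : ℝ) (N : ℕ) (a : ℕ → ℝ) {x : ℝ} (hx : 0 < x) :
    diffAct 4 (coeffT α hα Ω N)
        (fun x => (∑ k ∈ Finset.range (N + 1), C (a k) * xLaguerre α k).eval x) x =
      ∑ k ∈ Finset.range (N + 1), ∑ m ∈ Finset.range (N + 1),
        a k * matT α Ω N k m * (xLaguerre α m).eval x := by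
  have hp : polyFn (∑ k ∈ Finset.range (N + 1), C (a k) * xLaguerre α k) =
      ∑ k ∈ Finset.range (N + 1), a k • qfun α k := by
    refine ev_injective fun x => ?_
    rw [ev_polyFn, map_sum, eval_finsetSum]
    refine Finset.sum_congr rfl fun k _ => ?_
    rw [map_smul, eval_mul, eval_C]
    rfl
  have hT : diffOp 4 (coeffT α hα Ω N) = T α hα Ω N := (T_eq_symOp α hα Ω N).symm
  rw [diffAct_poly _ _ _ hx, hp, hT, map_sum, ← ev_eq_ext ⟨x, hx⟩, map_sum]
  refine Finset.sum_congr rfl fun k hk => ?_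
  have hk := Finset.mem_range.1 hk
  have hi := intertwines_T α hα Ω N
  rw [map_smul, map_smul, hi.2, bandAct_eq_sum_range hi.1 _ (K := N + 3) (by omega), map_sum,
    smul_eq_mul, Finset.mul_sum]
  symm
  refine (Finset.sum_subset (Finset.range_mono (by omega)) fun m _ hm => ?_).trans
    (Finset.sum_congr rfl fun m _ => ?_)
  · rw [Finset.mem_range, not_lt] at hm
    rw [matT_eq_zero α hα Ω (by omega) (by omega)]
    ring
  · rw [map_smul, smul_eq_mul, ← mul_assoc]
    rfl

/-- The coefficient `∫₀^Ω q_k f w dx`. -/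
def coeffS (α Ω : ℝ) (f : ℝ → ℝ) (k : ℕ) : ℝ :=
  ∫ x in Set.Ioo 0 Ω, weight α x * ((xLaguerre α k).eval x * f x)

/-- `S f` is the combination of `q_0, …, q_N` with coefficients `∫₀^Ω q_k f w dx`.
Integrability of the summands is needed to exchange the sum and the integral. -/
theorem S_eq_sum (α Ω : ℝ) (N : ℕ) {f : ℝ → ℝ}
    (hf : ∀ k, IntegrableOn (fun x => weight α x * ((xLaguerre α k).eval x * f x)) (Set.Ioo 0 Ω))
    (y : ℝ) :
    S α Ω N f y = (∑ k ∈ Finset.range (N + 1), C (coeffS α Ω f k) * xLaguerre α k).eval y := by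
  have e : ∀ x, (∑ k ∈ Finset.range (N + 1),
      (xLaguerre α k).eval x * (xLaguerre α k).eval y * weight α x) * f x =
      ∑ k ∈ Finset.range (N + 1), (xLaguerre α k).eval y *
        (weight α x * ((xLaguerre α k).eval x * f x)) := by
    intro x
    rw [Finset.sum_mul]
    exact Finset.sum_congr rfl fun k _ => by ring
  simp only [S, e]
  rw [integral_finsetSum _ fun k _ => (hf k).const_mul _, eval_finsetSum]
  refine Finset.sum_congr rfl fun k _ => ?_
  rw [integral_const_mul, eval_mul, eval_C, mul_comm]
  rfl

theorem integrableOn_weight_mul_poly_mul (α : ℝ) (hα : 0 < α) {Ω : ℝ} (p : ℝ[X]) {f : ℝ → ℝ}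
    (hf : BoundedC4 Ω f) :
    IntegrableOn (fun x => weight α x * (p.eval x * f x)) (Set.Ioo 0 Ω) := by
  obtain ⟨B, _, hB⟩ := hf.exists_bound
  have h := (integrableOn_weight_mul_poly α hα p).mono_set
    (Set.Ioo_subset_Ioi_self : Set.Ioo 0 Ω ⊆ _)
  have h2 := Integrable.bdd_mul (c := B) h
    (hf.1.continuousOn.aestronglyMeasurable measurableSet_Ioo)
    ((ae_restrict_iff' measurableSet_Ioo).2 (.of_forall fun x hx => by
      simpa using hB 0 (by norm_num) x hx))
  exact h2.congr (.of_forall fun x => by ring)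

theorem memLp_poly_restrict (α : ℝ) (hα : 0 < α) (Ω : ℝ) (p : ℝ[X]) :
    MemLp (fun x => p.eval x) 2 ((weightMeasure α).restrict (Set.Ioo 0 Ω)) :=
  (memLp_poly α hα p).restrict _

/-- Both `T (S f)` and `S (T f)` are the polynomial `∑_{k,m ≤ N} T_{k,m} ⟨q_k, f⟩ q_m`: the first
because the matrix of `T` splits at `N`, the second by Green's formula. -/
theorem commutation (α : ℝ) (hα : 0 < α) {Ω : ℝ} (hΩ : 0 < Ω) (N : ℕ) {f : ℝ → ℝ}
    (hf : f ∈ domT α Ω (coeffT α hα Ω N)) :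
    S α Ω N f ∈ domT α Ω (coeffT α hα Ω N) ∧
      ∀ y ∈ Set.Ioo 0 Ω, diffAct 4 (coeffT α hα Ω N) (S α Ω N f) y =
        S α Ω N (diffAct 4 (coeffT α hα Ω N) f) y := by
  have hfb : BoundedC4 Ω f := ⟨hf.1, hf.2.1⟩
  have hS : S α Ω N f = fun y =>
      (∑ k ∈ Finset.range (N + 1), C (coeffS α Ω f k) * xLaguerre α k).eval y :=
    funext (S_eq_sum α Ω N fun k => integrableOn_weight_mul_poly_mul α hα _ hfb)
  have hTS := fun y (hy : y ∈ Set.Ioo 0 Ω) =>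
    diffAct_coeffT_sum α hα Ω N (coeffS α Ω f) hy.1
  constructor
  · rw [hS]
    have hb := boundedC4_poly Ω (∑ k ∈ Finset.range (N + 1), C (coeffS α Ω f k) * xLaguerre α k)
    refine ⟨hb.1, hb.2, (memLp_poly_restrict α hα Ω (∑ k ∈ Finset.range (N + 1),
      ∑ m ∈ Finset.range (N + 1), C (coeffS α Ω f k * matT α Ω N k m) * xLaguerre α m)).ae_eq ?_⟩
    filter_upwards [ae_restrict_mem measurableSet_Ioo] with y hy
    rw [hTS y hy, eval_finsetSum]
    refine Finset.sum_congr rfl fun k _ => ?_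
    rw [eval_finsetSum]
    exact Finset.sum_congr rfl fun m _ => by rw [eval_mul, eval_C]
  · intro y hy
    have iT : ∀ p : ℝ[X], IntegrableOn (fun x => weight α x *
        (p.eval x * diffAct 4 (coeffT α hα Ω N) f x)) (Set.Ioo 0 Ω) := fun p =>
      (integrable_weightMeasure_restrict α hα Ω _).1
        ((memLp_poly_restrict α hα Ω p).integrable_mul hf.2.2)
    -- by Green's formula the matrix of `T` also acts on the coefficients of `f`
    have hc : ∀ k ∈ Finset.range (N + 1), coeffS α Ω (diffAct 4 (coeffT α hα Ω N) f) k =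
        ∑ m ∈ Finset.range (N + 1), matT α Ω N k m * coeffS α Ω f m := by
      intro k hk
      have hsingle : xLaguerre α k =
          ∑ j ∈ Finset.range (N + 1), C (if j = k then (1 : ℝ) else 0) * xLaguerre α j := by
        rw [Finset.sum_eq_single k]
        · simp
        · intro j _ hj
          simp [hj]
        · intro h
          exact absurd hk h
      have hTq : ∀ x ∈ Set.Ioo 0 Ω, diffAct 4 (coeffT α hα Ω N) (fun x => (xLaguerre α k).eval x) x
          = ∑ m ∈ Finset.range (N + 1), matT α Ω N k m * (xLaguerre α m).eval x := by
        intro x hx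
        have h := diffAct_coeffT_sum α hα Ω N (fun j => if j = k then (1 : ℝ) else 0) hx.1
        rw [← hsingle] at h
        rw [h, Finset.sum_eq_single k]
        · simp
        · intro j _ hj
          simp [hj]
        · intro h
          exact absurd hk h
      have e : ∀ x ∈ Set.Ioo 0 Ω, weight α x * (f x *
          diffAct 4 (coeffT α hα Ω N) (fun x => (xLaguerre α k).eval x) x) =
          ∑ m ∈ Finset.range (N + 1), matT α Ω N k m *
            (weight α x * ((xLaguerre α m).eval x * f x)) := by
        intro x hx
        rw [hTq x hx, Finset.mul_sum, Finset.mul_sum]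
        exact Finset.sum_congr rfl fun m _ => by ring
      have im : ∀ m ∈ Finset.range (N + 1), IntegrableOn (fun x => matT α Ω N k m *
          (weight α x * ((xLaguerre α m).eval x * f x))) (Set.Ioo 0 Ω) := fun m _ =>
        Integrable.const_mul (integrableOn_weight_mul_poly_mul α hα (xLaguerre α m) hfb) _
      rw [coeffS, integral_green α hα hΩ N hfb (boundedC4_poly Ω (xLaguerre α k)) (iT _)
        ((integrableOn_congr_fun e measurableSet_Ioo).2 (integrable_finsetSum _ im)),
        setIntegral_congr_fun measurableSet_Ioo e, integral_finsetSum _ im]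
      exact Finset.sum_congr rfl fun m _ => integral_const_mul _ _
    rw [hS, hTS y hy, S_eq_sum α Ω N (fun k => iT _), eval_finsetSum, Finset.sum_comm]
    refine Finset.sum_congr rfl fun k hk => ?_
    rw [eval_mul, eval_C, hc k hk, Finset.sum_mul]
    refine Finset.sum_congr rfl fun m _ => ?_
    rw [(intertwines_T α hα Ω N).1.1.apply k m]
    ring

end ExLaguerre

end

theorem mainTheorem4 (α : ℝ) (hα : 0 < α) :
    -- the exceptional Laguerre polynomials: degrees, orthonormality and completeness
    (ExLaguerre.xLaguerre α 0 = 0 ∧ ∀ n : ℕ, 1 ≤ n → (ExLaguerre.xLaguerre α n).natDegree = n) ∧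
    (∀ m n : ℕ, 1 ≤ m → 1 ≤ n →
      ∫ x, (ExLaguerre.xLaguerre α m).eval x * (ExLaguerre.xLaguerre α n).eval x
        ∂(ExLaguerre.weightMeasure α) = if m = n then 1 else 0) ∧
    (∀ f : ℝ → ℝ, MemLp f 2 (ExLaguerre.weightMeasure α) →
      (∀ n : ℕ, 1 ≤ n →
        ∫ x, f x * (ExLaguerre.xLaguerre α n).eval x ∂(ExLaguerre.weightMeasure α) = 0) →
      f =ᵐ[ExLaguerre.weightMeasure α] 0) ∧
    -- `D_j q_n = L_j q_n` with symmetric difference operators `L_j`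
    (ExLaguerre.IsSymmBand 0 ExLaguerre.L0 ∧
      ∀ n, ExLaguerre.D0 α hα (ExLaguerre.qfun α n) =
        ExLaguerre.bandAct 0 ExLaguerre.L0 (ExLaguerre.qfun α) n) ∧
    (ExLaguerre.IsSymmBand 1 (ExLaguerre.L1 α) ∧
      ∀ n, ExLaguerre.D1 α hα (ExLaguerre.qfun α n) =
        ExLaguerre.bandAct 1 (ExLaguerre.L1 α) (ExLaguerre.qfun α) n) ∧
    (ExLaguerre.IsSymmBand 2 (ExLaguerre.L2 α) ∧
      ∀ n, ExLaguerre.D2 α (ExLaguerre.qfun α n) =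
        ExLaguerre.bandAct 2 (ExLaguerre.L2 α) (ExLaguerre.qfun α) n) ∧
    -- the eight operators are linearly independent elements of the Fourier algebra
    (∀ i, ExLaguerre.Y α hα i ∈ ExLaguerre.FourierSym (ExLaguerre.qfun α) 2 2) ∧
    LinearIndependent ℝ (ExLaguerre.Y α hα) ∧
    -- the operator `T`: symmetric form, order four, and commutation with `S` on `(0, Ω)`
    ∀ (Ω : ℝ) (N : ℕ), 0 < Ω →
      ExLaguerre.T α hα Ω N ∈ ExLaguerre.FourierSym (ExLaguerre.qfun α) 2 2 ∧
      ExLaguerre.T α hα Ω N =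
        ExLaguerre.mulOp (ExLaguerre.weightPow α hα (-1 / 2)) *
          (ExLaguerre.ddx ^ 2 * ExLaguerre.mulOp (ExLaguerre.f2 Ω) * ExLaguerre.ddx ^ 2 +
            ExLaguerre.ddx * ExLaguerre.mulOp (ExLaguerre.f1 α hα Ω N) * ExLaguerre.ddx +
            ExLaguerre.mulOp (ExLaguerre.f0 α hα Ω N)) *
          ExLaguerre.mulOp (ExLaguerre.weightPow α hα (1 / 2)) ∧
      ∃ c : ℕ → ExLaguerre.SmoothFn,
        ExLaguerre.T α hα Ω N = ExLaguerre.diffOp 4 c ∧ c 4 = ExLaguerre.f2 Ω ∧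
        ∀ f ∈ ExLaguerre.domT α Ω c,
          ExLaguerre.S α Ω N f ∈ ExLaguerre.domT α Ω c ∧
          ∀ y ∈ Set.Ioo 0 Ω,
            ExLaguerre.diffAct 4 c (ExLaguerre.S α Ω N f) y =
              ExLaguerre.S α Ω N (ExLaguerre.diffAct 4 c f) y := by
  open ExLaguerre in
  exact ⟨⟨xLaguerre_zero α, natDegree_xLaguerre α hα⟩, integral_xLaguerre_mul α hα,
    ae_eq_zero_of_orthogonal α hα, ⟨isSymmBand_L0, D0_qfun α hα⟩, ⟨isSymmBand_L1 α, D1_qfun α hα⟩,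
    ⟨isSymmBand_L2 α, D2_qfun α hα⟩, Y_mem_fourierSym α hα, linearIndependent_Y α hα,
    fun Ω N hΩ => ⟨T_mem_fourierSym α hα Ω N,
      (T_eq_symOp α hα Ω N).trans (conj_eq_symOp_gT α hα Ω N).symm,
      coeffT α hα Ω N, T_eq_symOp α hα Ω N, rfl, fun f hf => commutation α hα hΩ N hf⟩⟩
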